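/- **Setting.** Let $0<\mu<1$ and let $k\ge 1$ be an integer. $C^{k,\mu}(\mathbb R^2)$ is the space of $k$-times continuously differentiable functions whose partial derivatives of order at most $k$ are bounded and $\mu$-Hölder continuous. Let $\phi_0\in C^{k,\mu}(\mathbb R^2)$ be real-valued, suppose that $D_0=\{\phi_0>0\}$ is bounded and simply connected, and let $m>0$ be such that $|\nabla\phi_0(x)|\ge m$ whenever $\phi_0(x)=0$. For a differentiable $\phi:\mathbb R^2\to\mathbb R$ and an integer $M\ge1$ write $$|\nabla\phi|_{M\text{-}\inf}=\inf\{|\nabla\phi(x)| : \phi(x)\in[0,2/M]\},\qquad |\nabla\phi|_\mu=\sup_{x\ne y}\frac{|\nabla\phi(x)-\nabla\phi(y)|}{|x-y|^\mu},$$ and let $L\ge0$ be given by $\pi L^2=m(D_0)$, where $m(\cdot)$ is Lebesgue measure. Let $\rho\in C^\infty(\mathbb R)$ be supported in $[-1,1]$ with $0\le\rho\le1$ and $\int\rho=1$, let $\rho_n(s)=n\rho(ns)$, let $H(s)=1$ for $s\ge0$ and $H(s)=0$ for $s<0$, and let $H_n(s)=(\rho_n*H)(s-\tfrac1n)$. Let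 $\omega_0\in\mathbb R$ and $K(x)=\frac{1}{2\pi|x|^2}(-x_2,x_1)$. Let $(\omega^n,v_n)$ be the global classical solution of the vorticity equations $$\partial_t\omega^n+v_n\cdot\nabla\omega^n=0,\qquad \omega^n(\cdot,0)=\omega_0H_n(\phi_0),\qquad v_n(x,t)=\int_{\mathbb R^2}K(x-y)\,\omega^n(y,t)\,dy$$ for $t\in\mathbb R$ ($\omega^n$ being $C^1$ in $(x,t)$ and compactly supported in $x$, locally uniformly in $t$). Let $X_n$ be its particle-trajectory map, $\frac{d}{dt}X_n(\alpha,t)=v_n(X_n(\alpha,t),t)$, $X_n(\alpha,0)=\alpha$, and let $\phi^n(x,t)=\phi_0(X_n^{-1}(x,t))$, where $X_n^{-1}(\cdot,t)$ is the inverse of $X_n(\cdot,t)$. **Proposition 3.2.** There is a constant $C$, depending only on $\mu$, such that the following holds for all $k$, $\phi_0$ and $m$ as above. There is an integer $M\ge1$ such that $$|\nabla\phi_0|_{j\text{-}\inf}\ge m/2\quad\text{for all } j\ge M;\tag{$*$}$$ and for every $M\ge1$ satisfying $(*)$, every $n\ge M$, every $\rho$, every $\omega_0\in\mathbb R$, every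 solution $(\phi^n,v_n)$ as above and every $t\in\mathbb R$, the function $\phi^n(\cdot,t)$ is $C^1$, the quantity $$\Delta_n=\left(\frac{|\nabla\phi^n(\cdot,t)|_{M\text{-}\inf}}{|\nabla\phi^n(\cdot,t)|_\mu}\right)^{1/\mu}$$ is well defined with $0<\Delta_n<\infty$, the velocity $v_n(\cdot,t)$ is differentiable, and for every $x\in\mathbb R^2$ (with the operator norm of the matrix $\nabla v_n(x,t)$) $$|\nabla v_n(x,t)|\le C|\omega_0|\left(1+\log\left(1+\frac{L}{\Delta_n}\right)\right),$$ that is, $|\nabla v_n(\cdot,t)|_{L^\infty}$ is bounded by the right-hand side. -/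

import Mathlib

open MeasureTheory
open scoped Gradient

noncomputable section

namespace VortexPatch

/-- The plane with its Euclidean norm. -/
abbrev Plane : Type := EuclideanSpace ℝ (Fin 2)

/-- The class `C^{k,μ}(ℝ²)`: `k`-times continuously differentiable functions all of whose
derivatives of order at most `k` are bounded and `μ`-Hölder continuous. -/
def HolderClass (k : ℕ) (μ : ℝ) (f : Plane → ℝ) : Prop :=
  ContDiff ℝ k f ∧ ∀ j ≤ k,
    (∃ C : ℝ, ∀ x, ‖iteratedFDeriv ℝ j f x‖ ≤ C) ∧
    (∃ C : ℝ, ∀ x y, ‖iteratedFDeriv ℝ j f x - iteratedFDeriv ℝ j f y‖ ≤ C * ‖x - y‖ ^ μ)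

/-- `|∇φ|_inf`, the infimum of `|∇φ|` over the zero set of `φ`. -/
def gradInf (φ : Plane → ℝ) : ℝ :=
  sInf {r : ℝ | ∃ x, φ x = 0 ∧ r = ‖∇ φ x‖}

/-- `|∇φ|_{M-inf}`, the infimum of `|∇φ|` over `φ⁻¹([0, 2/M])`. -/
def gradLevelInf (M : ℕ) (φ : Plane → ℝ) : ℝ :=
  sInf {r : ℝ | ∃ x, φ x ∈ Set.Icc (0 : ℝ) (2 / (M : ℝ)) ∧ r = ‖∇ φ x‖}

/-- `|∇φ|_μ`, the `μ`-Hölder seminorm of `∇φ`. (An unbounded set has `sSup` equal to `0`.) -/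
def gradHolder (μ : ℝ) (φ : Plane → ℝ) : ℝ :=
  sSup {r : ℝ | ∃ x y, x ≠ y ∧ r = ‖∇ φ x - ∇ φ y‖ / ‖x - y‖ ^ μ}

/-- The length `(|∇φ|_{M-inf} / |∇φ|_μ)^{1/μ}`. Under Lean's conventions it is `0` as soon as
the infimum is `0` or the Hölder seminorm is zero or infinite. -/
def lengthScale (M : ℕ) (μ : ℝ) (φ : Plane → ℝ) : ℝ :=
  (gradLevelInf M φ / gradHolder μ φ) ^ (1 / μ)

/-- The patch `{φ > 0}`. -/
def patch (φ : Plane → ℝ) : Set Plane := {x | 0 < φ x}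

/-- The radius `L ≥ 0` with `π L² = m({φ > 0})`. -/
def patchRadius (φ : Plane → ℝ) : ℝ :=
  Real.sqrt (volume.real (patch φ) / Real.pi)

/-- `φ₀` is a `C^{k,μ}` initial scalar, with lower bound `m` for `|∇φ₀|_inf`. -/
structure IsInitialScalar (k : ℕ) (μ m : ℝ) (φ₀ : Plane → ℝ) : Prop where
  holder : HolderClass k μ φ₀
  pos : 0 < m
  gradInf_ge : m ≤ gradInf φ₀
  bounded : Bornology.IsBounded (patch φ₀)
  simplyConnected : IsSimplyConnected (patch φ₀)

/-- A mollifier on the line, supported in `[-1,1]`, with values in `[0,1]` and integral one. -/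
structure IsMollifier (ρ : ℝ → ℝ) : Prop where
  smooth : ContDiff ℝ (⊤ : ℕ∞) ρ
  support : tsupport ρ ⊆ Set.Icc (-1) 1
  nonneg : ∀ s, 0 ≤ ρ s
  le_one : ∀ s, ρ s ≤ 1
  integral : ∫ s, ρ s = 1

open Classical in
/-- The Heaviside function, with value `1` at `0`. -/
def heaviside (s : ℝ) : ℝ := if 0 ≤ s then 1 else 0

/-- `H_n(s) = (ρ_n * H)(s - 1/n)`, where `ρ_n(s) = n ρ(n s)`. -/
def smoothHeaviside (ρ : ℝ → ℝ) (n : ℕ) (s : ℝ) : ℝ :=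
  ∫ r, ((n : ℝ) * ρ ((n : ℝ) * r)) * heaviside ((s - 1 / (n : ℝ)) - r)

/-- The Biot-Savart kernel `K(x) = (2π)⁻¹ |x|⁻² (-x₂, x₁)`. -/
def biotSavartKernel (x : Plane) : Plane :=
  ((1 / (2 * Real.pi)) * (‖x‖ ^ 2)⁻¹) • !₂[-x 1, x 0]

/-- `(ω, v)` is a global classical solution of the two-dimensional vorticity equations
with initial vorticity `w₀`: `ω` is jointly continuously differentiable and compactly
supported in space, locally uniformly in time; the velocity is given by the Biot-Savart law. -/
structure IsVorticitySolution (w₀ : Plane → ℝ) (ω : ℝ → Plane → ℝ) (v : ℝ → Plane → Plane) :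
    Prop where
  contDiff : ContDiff ℝ 1 (fun p : ℝ × Plane => ω p.1 p.2)
  compactSupport : ∀ T : ℝ, ∃ R : ℝ, ∀ t x, |t| ≤ T → R < ‖x‖ → ω t x = 0
  transport : ∀ t x, deriv (fun s => ω s x) t + inner ℝ (v t x) (∇ (ω t) x) = 0
  initial : ∀ x, ω 0 x = w₀ x
  biotSavart : ∀ t x, v t x = ∫ y, ω t y • biotSavartKernel (x - y)

/-- `X` is the particle-trajectory mapping of `v`. -/
structure IsParticleTrajectory (v : ℝ → Plane → Plane) (X : ℝ → Plane → Plane) : Prop where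
  hasDerivAt : ∀ α t, HasDerivAt (fun s => X s α) (v t (X t α)) t
  initial : ∀ α, X 0 α = α

/-- The scalar `φ(x,t) = φ₀(X⁻¹(x,t))` transported by the trajectories; `X⁻¹(·,t)` is the
inverse function of `X(·,t)`. -/
def transportedScalar (φ₀ : Plane → ℝ) (X : ℝ → Plane → Plane) (t : ℝ) (x : Plane) : ℝ :=
  φ₀ (Function.invFun (X t) x)

/-- `(φ, v)` is the solution of the `n`-approximate vortex patch equations obtained by
transporting `φ₀` along the trajectories of the vorticity solution whose initial vorticity is
`ω₀ H_n(φ₀)`. -/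
def IsApproxSolution (ρ : ℝ → ℝ) (n : ℕ) (ω₀ : ℝ) (φ₀ : Plane → ℝ)
    (φ : ℝ → Plane → ℝ) (v : ℝ → Plane → Plane) : Prop :=
  ∃ (ω : ℝ → Plane → ℝ) (X : ℝ → Plane → Plane),
    IsVorticitySolution (fun x => ω₀ * smoothHeaviside ρ n (φ₀ x)) ω v ∧
    IsParticleTrajectory v X ∧
    φ = transportedScalar φ₀ X

/-- `M` is a positive integer so large that `|∇φ₀|_{j-inf} ≥ m/2` for all `j ≥ M`. -/
def SufficientlyLarge (m : ℝ) (φ₀ : Plane → ℝ) (M : ℕ) : Prop :=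
  1 ≤ M ∧ ∀ j ≥ M, m / 2 ≤ gradLevelInf j φ₀

end VortexPatch

end

noncomputable section

namespace VortexPatch

open Set Filter Topology

/-! ### Grönwall estimates, and the regularity and bijectivity of flow maps. -/

section Flow

variable {E : Type*} [NormedAddCommGroup E] [NormedSpace ℝ E]

/-! The velocity gradient is a singular integral of the vorticity against a kernel of size `|z|⁻²`.
Its absolute value diverges logarithmically at both ends. At infinity the bounds `|ω| ≤ |ω₀|` and `∫
|ω| ≤ |ω₀| π L²` suffice: they give `log (1 + L / r)` outside the disc of radius `r`
(`integral_far_le`). Near the point, cancellation is needed, and it is available up to a radius `r`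
comparable to `Δ_n`.

To avoid principal values, the kernel is smoothed at scale `ε` and the limit is taken
(`tendsto_integral_smoothKernelDeriv`). The derivative of the smoothed kernel is a bump of fixed
mass, which is harmless, plus a continuous kernel that is even, changes sign under a quarter turn,
and is bounded by `|z|⁻²` uniformly in `ε` (`IsStressKernel`). The quarter turn kills its integral
over discs and annuli; together with evenness it kills the integral over half-planes cut by an
annulus.

The mollified vorticity `ω₀ H_n(φ)` is an average of indicators of superlevel sets `{φ ≥ s}` with `0
≤ s ≤ 2/n`, so it suffices to treat one such set, and no constant depends on `n` or `ρ`
(`norm_integral_near_le`). This is done in `norm_setIntegral_superlevel_le`. Let `d` be the distance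
from the centre to the level set. The disc of radius `d` lies on one side of the level set and
contributes nothing. Beyond it, a Taylor expansion at the nearest point shows that the set agrees
with a half-plane through the centre, except in a strip of width of order `d` and a cusp of width of
order `|z| ^ (1 + μ)`. The integral of `|z|⁻²` over these is bounded in terms of `μ` alone
(`lintegral_errorRegion_le`).

The equation enters in two ways. Vorticity is carried by the trajectories and its integral is
conserved, which gives `ω = ω₀ H_n(φ)` at time `t` and the bound on `∫ |ω|`. The flow maps and their
inverses are of class `C^{1,μ}`, so `φ` stays `C^{1,μ}` with nonvanishing gradient on the relevant
levels and `Δ_n` is positive. The regularity constants of the flow depend on the solution and on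
time, but they serve only this qualitative purpose and do not enter `C`. -/

lemma gronwallBound_le {δ K ε x : ℝ} (hK : 0 ≤ K) (hε : 0 ≤ ε) :
    gronwallBound δ K ε x ≤ (δ + ε * x) * Real.exp (K * x) := by
  rcases hK.eq_or_lt with rfl | hK
  · simp [gronwallBound_K0]
  · rw [gronwallBound_of_K_ne_0 hK.ne']
    -- Equivalent to `e^y - 1 ≤ y e^y` with `y = K x`, which removes the division by `K` from the
    -- Grönwall bound.
    have h : 1 - K * x ≤ Real.exp (-(K * x)) := by
      have := Real.add_one_le_exp (-(K * x)); linarith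
    have h2 : Real.exp (K * x) - 1 ≤ K * x * Real.exp (K * x) := by
      have h3 : (1 - K * x) * Real.exp (K * x) ≤ Real.exp (-(K * x)) * Real.exp (K * x) := by
        gcongr
      rw [← Real.exp_add, neg_add_cancel, Real.exp_zero] at h3
      linarith
    have h4 : ε / K * (Real.exp (K * x) - 1) ≤ ε / K * (K * x * Real.exp (K * x)) := by
      gcongr
    have h5 : ε / K * (K * x * Real.exp (K * x)) = ε * x * Real.exp (K * x) := by
      field_simp
    simp only
    linarith

/-- Grönwall's inequality on a symmetric time interval, from an arbitrary base time. -/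
lemma norm_le_of_norm_deriv_le {f f' : ℝ → E} {T B ε t₀ s : ℝ} (hB : 0 ≤ B) (hε : 0 ≤ ε)
    (hf : ∀ s, HasDerivAt f (f' s) s) (hb : ∀ s, |s| ≤ T → ‖f' s‖ ≤ B * ‖f s‖ + ε)
    (ht₀ : |t₀| ≤ T) (hs : |s| ≤ T) :
    ‖f s‖ ≤ (‖f t₀‖ + 2 * T * ε) * Real.exp (2 * T * B) := by
  rw [abs_le] at ht₀ hs
  have key : ∀ x, 0 ≤ x → x ≤ 2 * T → gronwallBound ‖f t₀‖ B ε x ≤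
      (‖f t₀‖ + 2 * T * ε) * Real.exp (2 * T * B) := by
    intro x hx hx'
    refine (gronwallBound_le hB hε).trans ?_
    rw [mul_comm ε, mul_comm B]
    have hT : 0 ≤ T := by linarith
    gcongr
  rcases le_total t₀ s with h | h
  · refine le_trans ?_ (key (s - t₀) (by linarith) (by linarith))
    refine norm_le_gronwallBound_of_norm_deriv_right_le (f' := f') (b := s)
      (fun x _ => (hf x).continuousAt.continuousWithinAt)
      (fun x _ => (hf x).hasDerivWithinAt) le_rfl (fun x hx => hb x ?_) s ⟨h, le_rfl⟩
    exact abs_le.2 ⟨by linarith [hx.1], by linarith [hx.2]⟩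
  · have hg : ∀ r, HasDerivAt (fun r => f (-r)) (-(f' (-r))) r := by
      intro r
      simpa [Function.comp_def] using (hf (-r)).scomp r (hasDerivAt_neg r)
    refine le_trans ?_ (key (-s - -t₀) (by linarith) (by linarith))
    have := norm_le_gronwallBound_of_norm_deriv_right_le (f := fun r => f (-r))
      (f' := fun r => -(f' (-r))) (a := -t₀) (b := -s) (δ := ‖f t₀‖) (K := B) (ε := ε)
      (fun x _ => (hg x).continuousAt.continuousWithinAt)
      (fun x _ => (hg x).hasDerivWithinAt) (by simp) (fun x hx => ?_) (-s) ⟨by linarith, le_rfl⟩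
    · simpa using this
    · rw [norm_neg]
      exact hb (-x) (abs_le.2 ⟨by linarith [hx.2], by linarith [hx.1]⟩)

/-- A velocity field on `[-T, T]` whose spatial derivative is bounded by `B` and `μ`-Hölder
continuous with constant `H`, uniformly in time. -/
structure IsRegularField (v : ℝ → E → E) (T B H μ : ℝ) : Prop where
  T_nonneg : 0 ≤ T
  B_nonneg : 0 ≤ B
  H_nonneg : 0 ≤ H
  differentiable : ∀ t, |t| ≤ T → Differentiable ℝ (v t)
  fderiv_le : ∀ t, |t| ≤ T → ∀ x, ‖fderiv ℝ (v t) x‖ ≤ B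
  fderiv_holder : ∀ t, |t| ≤ T → ∀ x y,
    ‖fderiv ℝ (v t) x - fderiv ℝ (v t) y‖ ≤ H * ‖x - y‖ ^ μ

namespace IsRegularField

variable {v : ℝ → E → E} {T B H μ : ℝ}

lemma lipschitz (hv : IsRegularField v T B H μ) {t : ℝ} (ht : |t| ≤ T) (x y : E) :
    ‖v t x - v t y‖ ≤ B * ‖x - y‖ :=
  convex_univ.norm_image_sub_le_of_norm_fderiv_le (fun z _ => hv.differentiable t ht z)
    (fun z _ => hv.fderiv_le t ht z) (mem_univ y) (mem_univ x)

end IsRegularField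

/-- The first-order Taylor remainder of a function with `μ`-Hölder derivative. -/
lemma norm_sub_sub_fderiv_le {F : Type*} [NormedAddCommGroup F] [NormedSpace ℝ F] {f : E → F}
    {H μ : ℝ} (hμ : 0 < μ) (hH : 0 ≤ H) (hf : Differentiable ℝ f)
    (hh : ∀ x y, ‖fderiv ℝ f x - fderiv ℝ f y‖ ≤ H * ‖x - y‖ ^ μ) (x y : E) :
    ‖f y - f x - fderiv ℝ f x (y - x)‖ ≤ H * ‖y - x‖ ^ (1 + μ) := by
  have h := (convex_segment x y).norm_image_sub_le_of_norm_fderiv_le' (𝕜 := ℝ) (f := f)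
    (φ := fderiv ℝ f x) (C := H * ‖y - x‖ ^ μ) (fun z _ => hf z) (fun z hz => ?_)
    (left_mem_segment ℝ x y) (right_mem_segment ℝ x y)
  · rw [Real.rpow_one_add' (norm_nonneg _) (by linarith)]
    calc _ ≤ _ := h
      _ = _ := by ring
  · refine (hh z x).trans ?_
    gcongr
    exact norm_sub_le_of_mem_segment hz

/-- `f` solves the linear equation `f' = L f` up to an error of size `e` on `[-T, T]`. -/
def ApproxLinear (L : ℝ → E →L[ℝ] E) (T e : ℝ) (f : ℝ → E) : Prop :=
  ∃ f' : ℝ → E, (∀ s, HasDerivAt f (f' s) s) ∧ ∀ s, |s| ≤ T → ‖f' s - L s (f s)‖ ≤ e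

namespace ApproxLinear

variable {L L' : ℝ → E →L[ℝ] E} {T e e' : ℝ} {f g : ℝ → E}

lemma mono (hf : ApproxLinear L T e f) (h : e ≤ e') : ApproxLinear L T e' f := by
  obtain ⟨f', h1, h2⟩ := hf
  exact ⟨f', h1, fun s hs => (h2 s hs).trans h⟩

lemma sub (hf : ApproxLinear L T e f) (hg : ApproxLinear L T e' g) :
    ApproxLinear L T (e + e') (fun s => f s - g s) := by
  obtain ⟨f', h1, h2⟩ := hf
  obtain ⟨g', h3, h4⟩ := hg
  refine ⟨fun s => f' s - g' s, fun s => (h1 s).sub (h3 s), fun s hs => ?_⟩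
  have : f' s - g' s - L s (f s - g s) = (f' s - L s (f s)) - (g' s - L s (g s)) := by
    rw [map_sub]; abel
  rw [this]
  exact (norm_sub_le _ _).trans (add_le_add (h2 s hs) (h4 s hs))

lemma const_smul (hf : ApproxLinear L T e f) (c : ℝ) :
    ApproxLinear L T (|c| * e) (fun s => c • f s) := by
  obtain ⟨f', h1, h2⟩ := hf
  refine ⟨fun s => c • f' s, fun s => (h1 s).const_smul c, fun s hs => ?_⟩
  rw [map_smul, ← smul_sub, norm_smul, Real.norm_eq_abs]
  gcongr
  exact h2 s hs

/-- A change of coefficient is charged to the error. This allows linearisations along two different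
trajectories to be compared. -/
lemma change (hf : ApproxLinear L T e f) (h : ∀ s, |s| ≤ T → ‖L s - L' s‖ * ‖f s‖ ≤ e') :
    ApproxLinear L' T (e + e') f := by
  obtain ⟨f', h1, h2⟩ := hf
  refine ⟨f', h1, fun s hs => ?_⟩
  have : f' s - L' s (f s) = (f' s - L s (f s)) + (L s - L' s) (f s) := by
    simp
  rw [this]
  exact (norm_add_le _ _).trans (add_le_add (h2 s hs)
    (((L s - L' s).le_opNorm _).trans (h s hs)))

lemma norm_le {B t₀ s : ℝ} (hf : ApproxLinear L T e f) (hB : 0 ≤ B) (he : 0 ≤ e)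
    (hL : ∀ s, |s| ≤ T → ‖L s‖ ≤ B) (ht₀ : |t₀| ≤ T) (hs : |s| ≤ T) :
    ‖f s‖ ≤ (‖f t₀‖ + 2 * T * e) * Real.exp (2 * T * B) := by
  obtain ⟨f', h1, h2⟩ := hf
  refine norm_le_of_norm_deriv_le hB he h1 (fun r hr => ?_) ht₀ hs
  have : f' r = L r (f r) + (f' r - L r (f r)) := by abel
  rw [this]
  refine (norm_add_le _ _).trans (add_le_add (((L r).le_opNorm _).trans ?_) (h2 r hr))
  gcongr
  exact hL r hr

end ApproxLinear

/-- A family of trajectories of `v`, starting from the identity at time `t₀`. -/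
structure IsFlowFrom (v : ℝ → E → E) (t₀ : ℝ) (Y : ℝ → E → E) : Prop where
  hasDerivAt : ∀ x t, HasDerivAt (fun s => Y s x) (v t (Y t x)) t
  initial : ∀ x, Y t₀ x = x

namespace IsFlowFrom

variable {v : ℝ → E → E} {T B H μ t₀ : ℝ} {Y : ℝ → E → E}

lemma lipschitz (hY : IsFlowFrom v t₀ Y) (hv : IsRegularField v T B H μ) (ht₀ : |t₀| ≤ T)
    {s : ℝ} (hs : |s| ≤ T) (x y : E) :
    ‖Y s x - Y s y‖ ≤ Real.exp (2 * T * B) * ‖x - y‖ := by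
  have := norm_le_of_norm_deriv_le (f := fun s => Y s x - Y s y) hv.B_nonneg le_rfl
    (fun s => (hY.hasDerivAt x s).sub (hY.hasDerivAt y s))
    (fun s hs => by simpa using hv.lipschitz hs (Y s x) (Y s y)) ht₀ hs
  simp only [hY.initial, mul_zero, add_zero] at this
  linarith

/-- The defect is the Taylor remainder of the velocity, of order `1 + μ` in the separation of the
trajectories, which is at most `exp (2TB) ‖h‖`. -/
lemma approxLinear_sub (hY : IsFlowFrom v t₀ Y) (hv : IsRegularField v T B H μ) (hμ : 0 < μ)
    (ht₀ : |t₀| ≤ T) (x h : E) :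
    ApproxLinear (fun s => fderiv ℝ (v s) (Y s x)) T
      (H * Real.exp (2 * T * B) ^ (1 + μ) * ‖h‖ ^ (1 + μ)) (fun s => Y s (x + h) - Y s x) := by
  refine ⟨_, fun s => (hY.hasDerivAt _ s).sub (hY.hasDerivAt _ s), fun s hs => ?_⟩
  refine (norm_sub_sub_fderiv_le hμ hv.H_nonneg (hv.differentiable s hs)
    (hv.fderiv_holder s hs) (Y s x) (Y s (x + h))).trans ?_
  rw [mul_assoc, ← Real.mul_rpow (Real.exp_pos _).le (norm_nonneg _)]
  have := hY.lipschitz hv ht₀ hs (x + h) x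
  rw [add_sub_cancel_left] at this
  have := hv.H_nonneg
  gcongr

/-- Rescaled differences of trajectories solve the linearised equation approximately. -/
lemma approxLinear_quotient (hY : IsFlowFrom v t₀ Y) (hv : IsRegularField v T B H μ) (hμ : 0 < μ)
    (ht₀ : |t₀| ≤ T) (x h : E) {τ : ℝ} (hτ : 0 < τ) :
    ApproxLinear (fun s => fderiv ℝ (v s) (Y s x)) T
      (H * Real.exp (2 * T * B) ^ (1 + μ) * ‖h‖ ^ (1 + μ) * τ ^ μ)
      (fun s => τ⁻¹ • (Y s (x + τ • h) - Y s x)) := by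
  refine ((hY.approxLinear_sub hv hμ ht₀ x (τ • h)).const_smul τ⁻¹).mono (le_of_eq ?_)
  rw [norm_smul, Real.mul_rpow (norm_nonneg _) (norm_nonneg _), Real.norm_of_nonneg hτ.le,
    Real.rpow_one_add' hτ.le (by linarith), abs_of_pos (inv_pos.2 hτ)]
  field_simp

/-- The spatial derivative of a flow exists, is bounded and Hölder continuous. -/
theorem exists_hasFDerivAt [CompleteSpace E] (hY : IsFlowFrom v t₀ Y) (hv : IsRegularField v T B H μ) (hμ : 0 < μ)
    (ht₀ : |t₀| ≤ T) {s : ℝ} (hs : |s| ≤ T) :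
    ∃ (A : E → E →L[ℝ] E) (C : ℝ), 0 ≤ C ∧ (∀ x, HasFDerivAt (Y s) (A x) x) ∧
      (∀ x, ‖A x‖ ≤ Real.exp (2 * T * B)) ∧ ∀ x y, ‖A x - A y‖ ≤ C * ‖x - y‖ ^ μ := by
  have hT := hv.T_nonneg
  have hB := hv.B_nonneg
  have hH := hv.H_nonneg
  set Q := Real.exp (2 * T * B) with hQ
  have hQ0 : 0 < Q := Real.exp_pos _
  set C₀ := H * Q ^ (1 + μ) with hC₀
  have hC₀0 : 0 ≤ C₀ := by positivity
  have bd : ∀ (x : E) {e : ℝ} {f : ℝ → E}, 0 ≤ e →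
      ApproxLinear (fun s => fderiv ℝ (v s) (Y s x)) T e f →
      ‖f s‖ ≤ (‖f t₀‖ + 2 * T * e) * Q := fun x e f he hf =>
    hf.norm_le hB he (fun r hr => hv.fderiv_le r hr _) ht₀ hs
  set D : E → E → ℝ → E := fun x h τ => τ⁻¹ • (Y s (x + τ • h) - Y s x) with hD
  have hinit : ∀ (x h : E) {τ : ℝ}, 0 < τ → τ⁻¹ • (Y t₀ (x + τ • h) - Y t₀ x) = h := by
    intro x h τ hτ
    simp [hY.initial, smul_smul, hτ.ne']
  -- Both quotients equal `h` at time `t₀`, so their difference starts from zero and Grönwall's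
  -- inequality leaves only the defects.
  have hDD : ∀ x h {τ τ' : ℝ}, 0 < τ → 0 < τ' →
      ‖D x h τ - D x h τ'‖ ≤ 2 * T * Q * C₀ * ‖h‖ ^ (1 + μ) * (τ ^ μ + τ' ^ μ) := by
    intro x h τ τ' hτ hτ'
    have := bd x (by positivity) ((hY.approxLinear_quotient hv hμ ht₀ x h hτ).sub
      (hY.approxLinear_quotient hv hμ ht₀ x h hτ'))
    simp only [hinit x h hτ, hinit x h hτ', sub_self, norm_zero, zero_add] at this
    refine this.trans (le_of_eq ?_)
    ring
  have hDle : ∀ x h {τ : ℝ}, 0 < τ → ‖D x h τ‖ ≤ Q * ‖h‖ := by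
    intro x h τ hτ
    simp only [hD]
    rw [norm_smul, norm_inv, Real.norm_of_nonneg hτ.le, inv_mul_le_iff₀ hτ]
    have := hY.lipschitz hv ht₀ hs (x + τ • h) x
    rw [add_sub_cancel_left, norm_smul, Real.norm_of_nonneg hτ.le] at this
    linarith
  set τ : ℕ → ℝ := fun n => 1 / ((n : ℝ) + 1) with hτdef
  have hτ0 : ∀ n, 0 < τ n := fun n => by positivity
  have hτlim : Tendsto τ atTop (𝓝 0) := tendsto_one_div_add_atTop_nhds_zero_nat
  have hτμ : Tendsto (fun n => τ n ^ μ) atTop (𝓝 0) := by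
    have := hτlim.rpow_const (p := μ) (Or.inr hμ.le)
    rwa [Real.zero_rpow hμ.ne'] at this
  have hcauchy : ∀ x h, CauchySeq (fun n => D x h (τ n)) := by
    intro x h
    rw [Metric.cauchySeq_iff]
    intro ε hε
    set K := 2 * T * Q * C₀ * ‖h‖ ^ (1 + μ) with hK
    have hK0 : 0 ≤ K := by positivity
    have : ∀ᶠ n in atTop, τ n ^ μ < ε / (2 * (K + 1)) :=
      hτμ.eventually (gt_mem_nhds (by positivity))
    obtain ⟨N, hN⟩ := eventually_atTop.1 this
    refine ⟨N, fun m hm n hn => ?_⟩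
    rw [dist_eq_norm]
    refine (hDD x h (hτ0 m) (hτ0 n)).trans_lt ?_
    have h1 := hN m hm
    have h2 := hN n hn
    have h3 : 0 ≤ τ m ^ μ + τ n ^ μ :=
      add_nonneg (Real.rpow_nonneg (hτ0 m).le _) (Real.rpow_nonneg (hτ0 n).le _)
    calc K * (τ m ^ μ + τ n ^ μ) ≤ (K + 1) * (τ m ^ μ + τ n ^ μ) := by gcongr; linarith
      _ < (K + 1) * (ε / (2 * (K + 1)) + ε / (2 * (K + 1))) := by gcongr
      _ = ε := by field_simp; norm_num
  choose A hA using fun x h => cauchySeq_tendsto_of_complete (hcauchy x h)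
  -- Linearity of the limit: the corresponding combination of quotients vanishes at `t₀` and solves
  -- the linearised equation up to `O(τ ^ μ)`.
  have hAadd : ∀ x h k, A x (h + k) = A x h + A x k := by
    intro x h k
    have h1 := ((hA x (h + k)).sub (hA x h)).sub (hA x k)
    have h2 : Tendsto (fun n => D x (h + k) (τ n) - D x h (τ n) - D x k (τ n)) atTop (𝓝 0) := by
      have hz : Tendsto (fun n => 2 * T * Q * C₀ * (‖h + k‖ ^ (1 + μ) + ‖h‖ ^ (1 + μ) +
          ‖k‖ ^ (1 + μ)) * τ n ^ μ) atTop (𝓝 0) := by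
        simpa using hτμ.const_mul (2 * T * Q * C₀ * (‖h + k‖ ^ (1 + μ) + ‖h‖ ^ (1 + μ) +
          ‖k‖ ^ (1 + μ)))
      refine squeeze_zero_norm (fun n => ?_) hz
      have hn := hτ0 n
      have := bd x (by positivity) (((hY.approxLinear_quotient hv hμ ht₀ x (h + k) hn).sub
        (hY.approxLinear_quotient hv hμ ht₀ x h hn)).sub
        (hY.approxLinear_quotient hv hμ ht₀ x k hn))
      simp only [hinit x _ hn] at this
      rw [show h + k - h - k = 0 by abel, norm_zero, zero_add] at this
      refine this.trans (le_of_eq ?_)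
      ring
    have h3 := tendsto_nhds_unique h1 h2
    rw [sub_sub, sub_eq_zero] at h3
    exact h3
  have hAsmul : ∀ x (c : ℝ) h, A x (c • h) = c • A x h := by
    intro x c h
    have h1 := (hA x (c • h)).sub ((hA x h).const_smul c)
    have h2 : Tendsto (fun n => D x (c • h) (τ n) - c • D x h (τ n)) atTop (𝓝 0) := by
      have hz : Tendsto (fun n => 2 * T * Q * C₀ * (‖c • h‖ ^ (1 + μ) + |c| * ‖h‖ ^ (1 + μ))
          * τ n ^ μ) atTop (𝓝 0) := by
        simpa using hτμ.const_mul (2 * T * Q * C₀ * (‖c • h‖ ^ (1 + μ) + |c| * ‖h‖ ^ (1 + μ)))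
      refine squeeze_zero_norm (fun n => ?_) hz
      have hn := hτ0 n
      have := bd x (by positivity) ((hY.approxLinear_quotient hv hμ ht₀ x (c • h) hn).sub
        ((hY.approxLinear_quotient hv hμ ht₀ x h hn).const_smul c))
      simp only [hinit x _ hn] at this
      rw [sub_self, norm_zero, zero_add] at this
      refine this.trans (le_of_eq ?_)
      ring
    have h3 := tendsto_nhds_unique h1 h2
    rwa [sub_eq_zero] at h3
  have hAle : ∀ x h, ‖A x h‖ ≤ Q * ‖h‖ := fun x h =>
    le_of_tendsto (hA x h).norm (Eventually.of_forall fun n => hDle x h (hτ0 n))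
  -- At `τ = 1` the quotient is the increment itself. Comparing it with the limit `τ → 0` gives a
  -- remainder of order `‖h‖ ^ (1 + μ)`, hence Fréchet differentiability.
  have hAD : ∀ x h, ‖A x h - (Y s (x + h) - Y s x)‖ ≤
      2 * T * Q * C₀ * ‖h‖ ^ (1 + μ) := by
    intro x h
    have h1 : Tendsto (fun n => ‖D x h (τ n) - D x h 1‖) atTop (𝓝 ‖A x h - D x h 1‖) :=
      ((hA x h).sub_const _).norm
    have h2 : Tendsto (fun n => 2 * T * Q * C₀ * ‖h‖ ^ (1 + μ) * (τ n ^ μ + 1)) atTop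
        (𝓝 (2 * T * Q * C₀ * ‖h‖ ^ (1 + μ) * (0 + 1))) :=
      (hτμ.add_const 1).const_mul _
    have h3 := le_of_tendsto_of_tendsto' h1 h2 (fun n => by
      simpa using hDD x h (hτ0 n) one_pos)
    simpa [hD] using h3
  let A' : E → E →L[ℝ] E := fun x => LinearMap.mkContinuous
    { toFun := A x, map_add' := hAadd x, map_smul' := hAsmul x } Q (hAle x)
  refine ⟨A', 2 * T * Q * (H * Q ^ μ * Q), by positivity, fun x => ?_, fun x => ?_,
    fun x y => ?_⟩
  · rw [hasFDerivAt_iff_isLittleO_nhds_zero]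
    have h1 : (fun h => Y s (x + h) - Y s x - A' x h) =O[𝓝 0] fun h => ‖h‖ ^ (1 + μ) := by
      refine Asymptotics.IsBigO.of_bound (2 * T * Q * C₀) (Eventually.of_forall fun h => ?_)
      rw [norm_sub_rev, Real.norm_of_nonneg (by positivity)]
      exact hAD x h
    refine h1.trans_isLittleO ?_
    have h2 : Tendsto (fun h : E => ‖h‖ ^ μ) (𝓝 0) (𝓝 0) := by
      have := (tendsto_norm_zero (E := E)).rpow_const (p := μ) (Or.inr hμ.le)
      rwa [Real.zero_rpow hμ.ne'] at this
    rw [Asymptotics.isLittleO_iff]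
    intro c hc
    filter_upwards [h2.eventually (gt_mem_nhds hc)] with h hh
    rw [Real.norm_of_nonneg (by positivity), Real.rpow_one_add' (norm_nonneg _) (by linarith),
      mul_comm]
    gcongr
  · exact LinearMap.mkContinuous_norm_le _ hQ0.le _
  · refine ContinuousLinearMap.opNorm_le_bound _ (by positivity) fun h => ?_
    have h1 : Tendsto (fun n => ‖D x h (τ n) - D y h (τ n)‖) atTop (𝓝 ‖A x h - A y h‖) :=
      ((hA x h).sub (hA y h)).norm
    -- The cost of regarding the quotient at `y` as an approximate solution of the equation
    -- linearised along the trajectory of `x`.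
    set K := H * Q ^ μ * ‖x - y‖ ^ μ * (Q * ‖h‖) with hK
    have h2 : Tendsto (fun n => 2 * T * Q * (2 * (C₀ * ‖h‖ ^ (1 + μ)) * τ n ^ μ + K)) atTop
        (𝓝 (2 * T * Q * (2 * (C₀ * ‖h‖ ^ (1 + μ)) * 0 + K))) :=
      ((hτμ.const_mul _).add_const K).const_mul _
    have h3 := le_of_tendsto_of_tendsto' h1 h2 (fun n => ?_)
    · change ‖A x h - A y h‖ ≤ _
      refine h3.trans (le_of_eq ?_)
      rw [hK]
      ring
    · have hn := hτ0 n
      have := bd x (by positivity) ((hY.approxLinear_quotient hv hμ ht₀ x h hn).sub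
        ((hY.approxLinear_quotient hv hμ ht₀ y h hn).change (e' := K) (fun r hr => ?_)))
      · simp only [hinit _ _ hn] at this
        rw [sub_self, norm_zero, zero_add] at this
        refine this.trans (le_of_eq ?_)
        ring
      · rw [hK]
        have h5 : ‖(τ n)⁻¹ • (Y r (y + τ n • h) - Y r y)‖ ≤ Q * ‖h‖ := by
          rw [norm_smul, norm_inv, Real.norm_of_nonneg hn.le, inv_mul_le_iff₀ hn]
          have := hY.lipschitz hv ht₀ hr (y + τ n • h) y
          rw [add_sub_cancel_left, norm_smul, Real.norm_of_nonneg hn.le] at this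
          linarith
        have h6 : ‖fderiv ℝ (v r) (Y r y) - fderiv ℝ (v r) (Y r x)‖ ≤
            H * Q ^ μ * ‖x - y‖ ^ μ := by
          refine (hv.fderiv_holder r hr _ _).trans ?_
          rw [mul_assoc, ← Real.mul_rpow hQ0.le (norm_nonneg _), norm_sub_rev]
          have := hY.lipschitz hv ht₀ hr x y
          gcongr
        gcongr

/-- Each time-`t` map of a flow is onto. -/
theorem surjective [CompleteSpace E] (hY : IsFlowFrom v 0 Y) (hv : IsRegularField v T B H μ)
    {t : ℝ} (ht : |t| ≤ T) : Function.Surjective (Y t) := by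
  have hT := hv.T_nonneg
  have hB := hv.B_nonneg
  set Q := Real.exp (2 * T * B) with hQ
  have hQ0 : 0 < Q := Real.exp_pos _
  -- Surjectivity propagates over short times: the flow restarted at time `s` differs from the
  -- identity at time `r` by a map with Lipschitz constant `1/2`. A finite chain of such steps leads
  -- from `0` to `t`.
  have step : ∀ s r : ℝ, |s| ≤ T → |r| ≤ T → B * Q * |r - s| ≤ 1 / 2 →
      Function.Surjective (Y s) → Function.Surjective (Y r) := by
    intro s r hs hr hsr hsurj
    set Z : ℝ → E → E := fun q x => Y q (Function.invFun (Y s) x) with hZ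
    have hZf : IsFlowFrom v s Z :=
      ⟨fun x q => hY.hasDerivAt _ q, fun x => Function.invFun_eq (hsurj x)⟩
    suffices Function.Surjective (Z r) by
      intro y
      obtain ⟨x, hx⟩ := this y
      exact ⟨_, hx⟩
    have happ : ApproximatesLinearOn (Z r) ((ContinuousLinearEquiv.refl ℝ E : E ≃L[ℝ] E) : E →L[ℝ] E)
        univ (1 / 2) := by
      intro x _ y _
      set f : ℝ → E := fun q => Z q x - Z q y with hf
      have hder : ∀ q ∈ uIcc s r, HasDerivWithinAt f (v q (Z q x) - v q (Z q y)) (uIcc s r) q :=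
        fun q _ => ((hZf.hasDerivAt x q).sub (hZf.hasDerivAt y q)).hasDerivWithinAt
      have hbound : ∀ q ∈ uIcc s r, ‖v q (Z q x) - v q (Z q y)‖ ≤ B * Q * ‖x - y‖ := by
        intro q hq
        have hq' : |q| ≤ T := by
          rw [abs_le] at hs hr ⊢
          rw [mem_uIcc] at hq
          rcases hq with h | h <;> constructor <;> linarith [h.1, h.2]
        refine (hv.lipschitz hq' _ _).trans ?_
        rw [mul_assoc]
        gcongr
        exact hZf.lipschitz hv hs hq' x y
      have := (convex_uIcc s r).norm_image_sub_le_of_norm_hasDerivWithin_le hder hbound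
        left_mem_uIcc right_mem_uIcc
      have h2 : f r - f s = Z r x - Z r y - (x - y) := by
        simp [hf, hZf.initial]
      rw [h2, Real.norm_eq_abs] at this
      simp only [ContinuousLinearEquiv.coe_refl, ContinuousLinearMap.id_apply]
      refine this.trans ?_
      rw [show B * Q * ‖x - y‖ * |r - s| = (B * Q * |r - s|) * ‖x - y‖ by ring]
      have : ((1 / 2 : NNReal) : ℝ) = 1 / 2 := by norm_num
      rw [this]
      gcongr
    refine happ.surjective ?_
    rcases subsingleton_or_nontrivial E with h | h
    · exact Or.inl h
    · right
      simp only [ContinuousLinearEquiv.refl_symm, ContinuousLinearEquiv.coe_refl]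
      have : ‖ContinuousLinearMap.id ℝ E‖₊ = 1 := by
        ext; simp
      rw [this]
      norm_num [← NNReal.coe_lt_coe]
  obtain ⟨N, hN⟩ := exists_nat_gt (2 * (B * Q * T))
  have hN0 : (0 : ℝ) < N := lt_of_le_of_lt (by positivity) hN
  have hind : ∀ k : ℕ, k ≤ N → Function.Surjective (Y (k / N * t)) := by
    intro k
    induction k with
    | zero =>
      intro _ y
      exact ⟨y, by simp [hY.initial]⟩
    | succ k ih =>
      intro hk
      have hle : ∀ j : ℕ, j ≤ N → |(j : ℝ) / N * t| ≤ T := by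
        intro j hj
        rw [abs_mul, abs_of_nonneg (by positivity)]
        have h1 : (j : ℝ) / N ≤ 1 := by
          rw [div_le_one hN0]; exact_mod_cast hj
        calc (j : ℝ) / N * |t| ≤ 1 * T := by gcongr
          _ = T := one_mul _
      refine step _ _ (hle k (by omega)) (hle (k + 1) hk) ?_ (ih (by omega))
      have : ((k + 1 : ℕ) : ℝ) / N * t - (k : ℝ) / N * t = t / N := by
        push_cast; field_simp; ring
      rw [this, abs_div, abs_of_pos hN0, ← mul_div_assoc, div_le_iff₀ hN0]
      have : B * Q * |t| ≤ B * Q * T := by gcongr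
      linarith
  have := hind N le_rfl
  rwa [div_self hN0.ne', one_mul] at this

/-- Grönwall's inequality based at time `t`: trajectories that meet at time `t` coincide at time
`0`. -/
lemma injective (hY : IsFlowFrom v 0 Y) (hv : IsRegularField v T B H μ)
    {t : ℝ} (ht : |t| ≤ T) : Function.Injective (Y t) := by
  intro x y hxy
  have := norm_le_of_norm_deriv_le (f := fun s => Y s x - Y s y) (t₀ := t) (s := 0)
    hv.B_nonneg le_rfl
    (fun s => (hY.hasDerivAt x s).sub (hY.hasDerivAt y s))
    (fun s hs => by simpa using hv.lipschitz hs (Y s x) (Y s y)) ht (by simpa using hv.T_nonneg)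
  simp only [hY.initial, hxy, sub_self, norm_zero, mul_zero, add_zero, zero_mul] at this
  exact sub_eq_zero.1 (norm_le_zero_iff.1 this)

/-- The inverse of a flow map is the flow run backwards. -/
lemma invFun_isFlowFrom (hY : IsFlowFrom v 0 Y) {t : ℝ} (hs : Function.Surjective (Y t)) :
    IsFlowFrom v t (fun s x => Y s (Function.invFun (Y t) x)) :=
  ⟨fun _ q => hY.hasDerivAt _ q, fun x => Function.invFun_eq (hs x)⟩

end IsFlowFrom
end Flow

/-! ### The Biot-Savart kernel: size, Hölder bounds, integrability. -/

section Kernel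

/-- Rotation of the plane by a right angle. -/
def rot : Plane ≃ₗᵢ[ℝ] Plane :=
  LinearIsometry.toLinearIsometryEquiv
    { toFun := fun z => !₂[-z 1, z 0]
      map_add' := fun x y => by ext i; fin_cases i <;> simp; ring
      map_smul' := fun c x => by ext i; fin_cases i <;> simp
      norm_map' := fun x => by
        simp [EuclideanSpace.norm_eq, Fin.sum_univ_two, add_comm] } rfl

lemma rot_apply (z : Plane) : rot z = !₂[-z 1, z 0] := rfl

@[simp] lemma inner_rot_self (z : Plane) : inner ℝ (rot z) z = 0 := by
  simp [rot_apply, PiLp.inner_apply, Fin.sum_univ_two]; ring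

lemma biotSavartKernel_eq (z : Plane) :
    biotSavartKernel z = (1 / (2 * Real.pi) * (‖z‖ ^ 2)⁻¹) • rot z := rfl

lemma norm_biotSavartKernel (z : Plane) :
    ‖biotSavartKernel z‖ = 1 / (2 * Real.pi) * ‖z‖⁻¹ := by
  rw [biotSavartKernel_eq, norm_smul, LinearIsometryEquiv.norm_map, Real.norm_of_nonneg
    (by positivity)]
  rcases eq_or_ne ‖z‖ 0 with h | h
  · simp [h]
  · field_simp

lemma inv_two_pi_le_one : 1 / (2 * Real.pi) ≤ 1 := by
  rw [div_le_one (by positivity)]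
  linarith [Real.pi_gt_three]

lemma norm_biotSavartKernel_le (z : Plane) : ‖biotSavartKernel z‖ ≤ ‖z‖ ^ (-1 : ℝ) := by
  rw [norm_biotSavartKernel, Real.rpow_neg_one]
  exact mul_le_of_le_one_left (by positivity) inv_two_pi_le_one

lemma measurable_biotSavartKernel : Measurable biotSavartKernel := by
  have : biotSavartKernel = fun z : Plane => (1 / (2 * Real.pi) * (‖z‖ ^ 2)⁻¹) • rot z := rfl
  rw [this]
  have h : Measurable (rot : Plane → Plane) := rot.continuous.measurable
  fun_prop

/-- The kernel is a rotated inversion, for which the distance of images is `|a - b| / (|a| |b|)`.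
Writing `|a - b| ≤ |a - b| ^ μ (|a| + |b|) ^ (1 - μ)` trades part of this Lipschitz bound for
singularities of order `1 + μ < 2`, which are integrable in the plane. -/
lemma norm_biotSavartKernel_sub_le {μ : ℝ} (hμ₀ : 0 < μ) (hμ₁ : μ < 1) (a b : Plane) :
    ‖biotSavartKernel a - biotSavartKernel b‖ ≤
      ‖a - b‖ ^ μ * (2 * (‖a‖ ^ (-(1 + μ)) + ‖b‖ ^ (-(1 + μ)))) := by
  -- Since `0⁻¹ = 0`, the kernel vanishes at the origin, but so does `0 ^ (-(1 + μ))`. If `a` or `b`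
  -- is zero, the other summand alone must carry the bound.
  have hzero : biotSavartKernel 0 = 0 := by simp [biotSavartKernel_eq]
  have one : ∀ z : Plane, ‖biotSavartKernel z‖ ≤ ‖z‖ ^ μ * (2 * ‖z‖ ^ (-(1 + μ))) := by
    intro z
    refine (norm_biotSavartKernel_le z).trans ?_
    rcases eq_or_ne z 0 with rfl | hz
    · simp [Real.zero_rpow, hμ₀.ne']
    · have hz' : 0 < ‖z‖ := norm_pos_iff.2 hz
      rw [mul_left_comm, ← Real.rpow_add hz', show μ + -(1 + μ) = -1 by ring]
      have := Real.rpow_nonneg hz'.le (-1)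
      linarith
  rcases eq_or_ne a 0 with rfl | ha
  · rw [hzero, zero_sub, zero_sub, norm_neg, norm_neg, norm_zero,
      Real.zero_rpow (by linarith), zero_add]
    exact one b
  rcases eq_or_ne b 0 with rfl | hb
  · rw [hzero, sub_zero, sub_zero, norm_zero, Real.zero_rpow (by linarith), add_zero]
    exact one a
  have ha' : 0 < ‖a‖ := norm_pos_iff.2 ha
  have hb' : 0 < ‖b‖ := norm_pos_iff.2 hb
  have h1 : ‖biotSavartKernel a - biotSavartKernel b‖ ≤ ‖a - b‖ / (‖a‖ * ‖b‖) := by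
    have key := dist_div_norm_sq_smul ha hb 1
    have : biotSavartKernel a - biotSavartKernel b =
        (1 / (2 * Real.pi)) • rot ((1 / ‖a‖) ^ 2 • a - (1 / ‖b‖) ^ 2 • b) := by
      rw [biotSavartKernel_eq, biotSavartKernel_eq, map_sub, map_smul, map_smul, smul_sub,
        smul_smul, smul_smul]
      simp
    rw [this, norm_smul, LinearIsometryEquiv.norm_map, ← dist_eq_norm, key, dist_eq_norm,
      Real.norm_of_nonneg (by positivity)]
    refine (mul_le_of_le_one_left (by positivity) inv_two_pi_le_one).trans (le_of_eq ?_)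
    ring
  have h2 : ‖a - b‖ ≤ ‖a - b‖ ^ μ * (‖a‖ + ‖b‖) ^ (1 - μ) := by
    rcases eq_or_ne (‖a - b‖) 0 with h | h
    · simp [h, hμ₀.ne']
    · have h' : 0 < ‖a - b‖ := lt_of_le_of_ne (norm_nonneg _) h.symm
      calc ‖a - b‖ = ‖a - b‖ ^ μ * ‖a - b‖ ^ (1 - μ) := by
            rw [← Real.rpow_add h']; simp
        _ ≤ _ := by
            gcongr
            exact norm_sub_le a b
  refine h1.trans ?_
  calc ‖a - b‖ / (‖a‖ * ‖b‖) ≤ (‖a - b‖ ^ μ * (‖a‖ + ‖b‖) ^ (1 - μ)) / (‖a‖ * ‖b‖) := by gcongr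
    _ = ‖a - b‖ ^ μ * ((‖a‖ + ‖b‖) ^ (1 - μ) / (‖a‖ * ‖b‖)) := by ring
    _ ≤ _ := by
      gcongr
      clear h1 h2
      have gen : ∀ p q : ℝ, 0 < p → p ≤ q →
          (p + q) ^ (1 - μ) / (p * q) ≤ 2 * p ^ (-(1 + μ)) := by
        intro p q hp hpq
        have hq : 0 < q := hp.trans_le hpq
        have e1 : (p + q) ^ (1 - μ) ≤ 2 * q ^ (1 - μ) := by
          calc (p + q) ^ (1 - μ) ≤ (2 * q) ^ (1 - μ) := by
                gcongr
                linarith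
            _ = 2 ^ (1 - μ) * q ^ (1 - μ) := Real.mul_rpow (by norm_num) hq.le
            _ ≤ 2 * q ^ (1 - μ) := by
                gcongr
                calc (2 : ℝ) ^ (1 - μ) ≤ 2 ^ (1 : ℝ) := by
                      gcongr
                      · norm_num
                      · linarith
                  _ = 2 := Real.rpow_one 2
        calc (p + q) ^ (1 - μ) / (p * q) ≤ 2 * q ^ (1 - μ) / (p * q) := by gcongr
          _ = 2 * (p⁻¹ * q ^ (-μ)) := by
              rw [sub_eq_add_neg, Real.rpow_add hq, Real.rpow_one]; field_simp
          _ ≤ 2 * (p⁻¹ * p ^ (-μ)) := by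
              gcongr 2 * (p⁻¹ * ?_)
              exact Real.rpow_le_rpow_of_nonpos hp hpq (by linarith)
          _ = 2 * p ^ (-(1 + μ)) := by
              rw [neg_add, Real.rpow_add hp, Real.rpow_neg_one]
      rcases le_total ‖a‖ ‖b‖ with h | h
      · have := gen _ _ ha' h
        have := Real.rpow_nonneg hb'.le (-(1 + μ))
        linarith
      · have := gen _ _ hb' h
        have := Real.rpow_nonneg ha'.le (-(1 + μ))
        rw [add_comm ‖a‖, mul_comm ‖a‖ ‖b‖]
        linarith

/-- Negative powers of the norm above the critical exponent are integrable over balls, with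
bounds that do not depend on the centre. -/
lemma exists_integral_rpow_le {a : ℝ} (ha₀ : 0 ≤ a) (ha : a < 2) (R : ℝ) :
    ∃ C, 0 ≤ C ∧ ∀ x : Plane,
      IntegrableOn (fun y => ‖x - y‖ ^ (-a)) (Metric.closedBall 0 R) volume ∧
      ∫ y in Metric.closedBall (0 : Plane) R, ‖x - y‖ ^ (-a) ≤ C := by
  have h1 : IntegrableOn (fun z : Plane => ‖z‖ ^ (-a)) (Metric.ball 0 1) volume := by
    rw [integrableOn_fun_norm_addHaar volume (f := fun r => r ^ (-a))]
    have : IntegrableOn (fun y : ℝ => y ^ (1 - a)) (Ioo 0 1) volume := by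
      rw [← integrableOn_Ioc_iff_integrableOn_Ioo,
        ← intervalIntegrable_iff_integrableOn_Ioc_of_le zero_le_one]
      exact intervalIntegral.intervalIntegrable_rpow' (by linarith)
    refine this.congr_fun (fun y hy => ?_) measurableSet_Ioo
    simp only [finrank_euclideanSpace, Fintype.card_fin, smul_eq_mul]
    rw [sub_eq_add_neg, Real.rpow_add hy.1, Real.rpow_one, pow_one]
  -- The power is dominated by an integrable function `F` plus `1`. The integral of `F` is
  -- translation invariant, so the bound does not depend on the centre.
  set F : Plane → ℝ := (Metric.ball (0 : Plane) 1).indicator fun z => ‖z‖ ^ (-a) with hF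
  have hFi : Integrable F volume := h1.integrable_indicator measurableSet_ball
  have hle : ∀ z : Plane, ‖z‖ ^ (-a) ≤ F z + 1 := by
    intro z
    by_cases hz : z ∈ Metric.ball (0 : Plane) 1
    · simp [hF, hz]
    · rw [hF, indicator_of_notMem hz, zero_add]
      refine Real.rpow_le_one_of_one_le_of_nonpos ?_ (by linarith)
      simpa using hz
  have hF0 : ∀ z, 0 ≤ F z := fun z => indicator_nonneg (fun _ _ => by positivity) _
  have hfin : volume (Metric.closedBall (0 : Plane) R) ≠ ⊤ := measure_closedBall_lt_top.ne
  refine ⟨(∫ z, F z) + volume.real (Metric.closedBall (0 : Plane) R), ?_, fun x => ?_⟩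
  · exact add_nonneg (integral_nonneg hF0) measureReal_nonneg
  have hFx : Integrable (fun y => F (x - y)) volume := hFi.comp_sub_left x
  have hdom : IntegrableOn (fun y => F (x - y) + 1) (Metric.closedBall (0 : Plane) R) volume :=
    hFx.integrableOn.add (integrableOn_const hfin)
  have hint : IntegrableOn (fun y => ‖x - y‖ ^ (-a)) (Metric.closedBall 0 R) volume := by
    refine hdom.mono' (by
      have : Measurable fun y : Plane => ‖x - y‖ ^ (-a) := by fun_prop
      exact this.aestronglyMeasurable) (Eventually.of_forall fun y => ?_)
    rw [Real.norm_of_nonneg (by positivity)]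
    exact hle _
  refine ⟨hint, (integral_mono hint hdom fun y => hle _).trans ?_⟩
  rw [integral_add hFx.integrableOn (integrableOn_const hfin), setIntegral_const, smul_eq_mul,
    mul_one, ← integral_sub_left_eq_self F volume x]
  exact add_le_add_left (setIntegral_le_integral hFx (Eventually.of_forall fun y => hF0 _)) _

/-- The velocity generated by the vorticity `w`. -/
def biotSavart (w : Plane → ℝ) (x : Plane) : Plane := ∫ y, w y • biotSavartKernel (x - y)

lemma integrableOn_biotSavartKernel (x : Plane) (R : ℝ) :
    IntegrableOn (fun y => biotSavartKernel (x - y)) (Metric.closedBall 0 R) volume := by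
  obtain ⟨C, _, hC⟩ := exists_integral_rpow_le zero_le_one one_lt_two R
  refine (hC x).1.mono' ?_ (Eventually.of_forall fun y => norm_biotSavartKernel_le _)
  exact (measurable_biotSavartKernel.comp (by fun_prop)).aestronglyMeasurable

lemma locallyIntegrable_biotSavartKernel : LocallyIntegrable biotSavartKernel volume := by
  rw [locallyIntegrable_iff]
  intro k hk
  obtain ⟨R, hR⟩ := hk.isBounded.subset_closedBall 0
  have h := integrableOn_biotSavartKernel 0 R
  have : (fun y => biotSavartKernel (0 - y)) = fun y => -biotSavartKernel y := by
    ext1 y; simp [biotSavartKernel_eq]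
  rw [this] at h
  simpa using (h.neg).mono_set hR

lemma biotSavart_eq_setIntegral {g : Plane → ℝ} {R : ℝ} (hR : ∀ x, R < ‖x‖ → g x = 0) (x : Plane) :
    biotSavart g x = ∫ y in Metric.closedBall 0 R, g y • biotSavartKernel (x - y) := by
  rw [biotSavart, setIntegral_eq_integral_of_forall_compl_eq_zero]
  intro y hy
  rw [hR y (by simpa using hy), zero_smul]

lemma integrableOn_smul_biotSavartKernel {g : Plane → ℝ} (hg : Continuous g) (R : ℝ) (x : Plane) :
    IntegrableOn (fun y => g y • biotSavartKernel (x - y)) (Metric.closedBall 0 R) volume :=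
  (integrableOn_biotSavartKernel x R).continuousOn_smul hg.continuousOn
    (isCompact_closedBall 0 R)

/-- Bounds on the velocity by the supremum of the vorticity, uniform over vorticities supported
in a given disc. -/
lemma exists_norm_biotSavart_le {μ : ℝ} (hμ₀ : 0 < μ) (hμ₁ : μ < 1) (R : ℝ) :
    ∃ C, 0 ≤ C ∧ ∀ (g : Plane → ℝ) (G : ℝ), Continuous g → (∀ x, |g x| ≤ G) →
      (∀ x, R < ‖x‖ → g x = 0) → (∀ x, ‖biotSavart g x‖ ≤ C * G) ∧
      ∀ x y, ‖biotSavart g x - biotSavart g y‖ ≤ C * G * ‖x - y‖ ^ μ := by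
  obtain ⟨C₁, hC₁, h₁⟩ := exists_integral_rpow_le zero_le_one one_lt_two R
  obtain ⟨C₂, hC₂, h₂⟩ := exists_integral_rpow_le (a := 1 + μ) (by linarith) (by linarith) R
  refine ⟨C₁ + 4 * C₂, by positivity, fun g G hg hG hR => ?_⟩
  have hG0 : 0 ≤ G := (abs_nonneg _).trans (hG 0)
  constructor
  · intro x
    rw [biotSavart_eq_setIntegral hR]
    calc _ ≤ ∫ y in Metric.closedBall (0 : Plane) R, G * ‖x - y‖ ^ (-1 : ℝ) := by
          refine norm_integral_le_of_norm_le ((h₁ x).1.const_mul G) (Eventually.of_forall fun y => ?_)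
          rw [norm_smul, Real.norm_eq_abs]
          gcongr
          · exact hG y
          · exact norm_biotSavartKernel_le _
      _ = G * ∫ y in Metric.closedBall (0 : Plane) R, ‖x - y‖ ^ (-1 : ℝ) := integral_const_mul _ _
      _ ≤ G * (C₁ + 4 * C₂) := by
          gcongr
          linarith [(h₁ x).2]
      _ = _ := mul_comm _ _
  · intro x y
    rw [biotSavart_eq_setIntegral hR, biotSavart_eq_setIntegral hR, ← integral_sub
      (integrableOn_smul_biotSavartKernel hg R x) (integrableOn_smul_biotSavartKernel hg R y)]
    have hi := ((h₂ x).1.add (h₂ y).1).const_mul (G * (‖x - y‖ ^ μ * 2))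
    calc _ ≤ ∫ z in Metric.closedBall (0 : Plane) R, G * (‖x - y‖ ^ μ * 2) *
          (‖x - z‖ ^ (-(1 + μ)) + ‖y - z‖ ^ (-(1 + μ))) := by
          refine norm_integral_le_of_norm_le hi (Eventually.of_forall fun z => ?_)
          rw [← smul_sub, norm_smul, Real.norm_eq_abs, mul_assoc, mul_assoc]
          gcongr
          · exact hG z
          · have := norm_biotSavartKernel_sub_le hμ₀ hμ₁ (x - z) (y - z)
            rwa [sub_sub_sub_cancel_right] at this
      _ = G * (‖x - y‖ ^ μ * 2) * ((∫ z in Metric.closedBall (0 : Plane) R, ‖x - z‖ ^ (-(1 + μ))) +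
            ∫ z in Metric.closedBall (0 : Plane) R, ‖y - z‖ ^ (-(1 + μ))) := by
          rw [integral_const_mul, integral_add (h₂ x).1 (h₂ y).1]
      _ ≤ G * (‖x - y‖ ^ μ * 2) * (C₂ + C₂) := by
          gcongr
          · exact (h₂ x).2
          · exact (h₂ y).2
      _ ≤ _ := by
          have : 0 ≤ C₁ * G * ‖x - y‖ ^ μ := by positivity
          linarith

/-! ### Differentiability of the velocity. -/

section Derivative

variable {w : Plane → ℝ}

lemma biotSavart_eq_integral_sub (w : Plane → ℝ) (x : Plane) :
    biotSavart w x = ∫ z, w (x - z) • biotSavartKernel z := by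
  rw [biotSavart, ← integral_sub_left_eq_self (fun y => w y • biotSavartKernel (x - y)) volume x]
  simp

/-- The velocity is a convolution of a locally integrable kernel with `w`, so the derivative falls
on `w`. -/
lemma hasFDerivAt_biotSavart (hw : ContDiff ℝ 1 w) (hc : HasCompactSupport w) (x : Plane) :
    ∃ A : Plane →L[ℝ] Plane, HasFDerivAt (biotSavart w) A x ∧
      ∀ e, A e = biotSavart (fun y => fderiv ℝ w y e) x := by
  set L : Plane →L[ℝ] ℝ →L[ℝ] Plane := (ContinuousLinearMap.lsmul ℝ ℝ).flip with hL
  have h := hc.hasFDerivAt_convolution_right L locallyIntegrable_biotSavartKernel hw x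
  have heq : convolution biotSavartKernel w L volume = biotSavart w := by
    ext1 y
    rw [biotSavart_eq_integral_sub, convolution_def]
    simp [hL]
  rw [heq] at h
  refine ⟨_, h, fun e => ?_⟩
  rw [convolution_def, biotSavart_eq_integral_sub]
  have hi := (hc.fderiv ℝ).convolutionExists_right (L.precompR Plane)
    locallyIntegrable_biotSavartKernel (hw.continuous_fderiv one_ne_zero) x
  rw [ContinuousLinearMap.integral_apply hi]
  simp [hL]

lemma differentiable_biotSavart (hw : ContDiff ℝ 1 w) (hc : HasCompactSupport w) :
    Differentiable ℝ (biotSavart w) := fun x =>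
  (hasFDerivAt_biotSavart hw hc x).choose_spec.1.differentiableAt

lemma fderiv_biotSavart_apply (hw : ContDiff ℝ 1 w) (hc : HasCompactSupport w) (x e : Plane) :
    fderiv ℝ (biotSavart w) x e = biotSavart (fun y => fderiv ℝ w y e) x := by
  obtain ⟨A, hA, hAe⟩ := hasFDerivAt_biotSavart hw hc x
  rw [hA.fderiv, hAe]

/-- Bounds on the velocity gradient by the supremum of the vorticity gradient. -/
lemma exists_norm_fderiv_biotSavart_le {μ : ℝ} (hμ₀ : 0 < μ) (hμ₁ : μ < 1) (R : ℝ) :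
    ∃ C, 0 ≤ C ∧ ∀ (w : Plane → ℝ) (G : ℝ), ContDiff ℝ 1 w → (∀ x, ‖fderiv ℝ w x‖ ≤ G) →
      (∀ x, R < ‖x‖ → w x = 0) → (∀ x, ‖fderiv ℝ (biotSavart w) x‖ ≤ C * G) ∧
      ∀ x y, ‖fderiv ℝ (biotSavart w) x - fderiv ℝ (biotSavart w) y‖ ≤ C * G * ‖x - y‖ ^ μ := by
  obtain ⟨C, hC, h⟩ := exists_norm_biotSavart_le hμ₀ hμ₁ R
  refine ⟨C, hC, fun w G hw hG hR => ?_⟩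
  have hG0 : 0 ≤ G := (norm_nonneg _).trans (hG 0)
  have hc : HasCompactSupport w := HasCompactSupport.intro (isCompact_closedBall 0 R)
    fun x hx => hR x (by simpa using hx)
  have hfd : ∀ e x, R < ‖x‖ → fderiv ℝ w x e = 0 := by
    intro e x hx
    have : w =ᶠ[𝓝 x] fun _ => 0 := by
      filter_upwards [continuous_norm.continuousAt.eventually (lt_mem_nhds hx)] with y hy
      exact hR y hy
    rw [this.fderiv_eq]
    simp
  have key := fun e => h (fun y => fderiv ℝ w y e) (G * ‖e‖)
    ((hw.continuous_fderiv one_ne_zero).clm_apply continuous_const)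
    (fun x => ((fderiv ℝ w x).le_opNorm e).trans (by gcongr; exact hG x)) (hfd e)
  constructor
  · intro x
    refine ContinuousLinearMap.opNorm_le_bound _ (by positivity) fun e => ?_
    rw [fderiv_biotSavart_apply hw hc]
    exact ((key e).1 x).trans (le_of_eq (by ring))
  · intro x y
    refine ContinuousLinearMap.opNorm_le_bound _ (by positivity) fun e => ?_
    rw [sub_apply, fderiv_biotSavart_apply hw hc, fderiv_biotSavart_apply hw hc]
    exact ((key e).2 x y).trans (le_of_eq (by ring))

end Derivative

end Kernel

/-! ### The smoothed kernel and the velocity gradient as a limit. -/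

section Regularised

/-- The Biot-Savart kernel with its singularity smoothed at scale `ε`. -/
def smoothKernel (ε : ℝ) (z : Plane) : Plane :=
  (1 / (2 * Real.pi) * (‖z‖ ^ 2 + ε ^ 2)⁻¹) • rot z

/-- `|z|²` times the reflection of `e` in the line spanned by `z`. -/
def scaledReflection (z e : Plane) : Plane := (2 * inner ℝ z e) • z - ‖z‖ ^ 2 • e

/-- The derivative of `smoothKernel ε` at `z` in the direction `e`. -/
def smoothKernelDeriv (ε : ℝ) (z e : Plane) : Plane :=
  (1 / (2 * Real.pi)) • rot ((ε ^ 2 / (‖z‖ ^ 2 + ε ^ 2) ^ 2) • e -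
    ((‖z‖ ^ 2 + ε ^ 2) ^ 2)⁻¹ • scaledReflection z e)

lemma norm_scaledReflection (z e : Plane) : ‖scaledReflection z e‖ = ‖z‖ ^ 2 * ‖e‖ := by
  rw [← sq_eq_sq₀ (norm_nonneg _) (by positivity), scaledReflection, norm_sub_sq_real, norm_smul,
    norm_smul, inner_smul_left, inner_smul_right, Real.norm_eq_abs, mul_pow, sq_abs]
  simp
  ring

lemma scaledReflection_neg (z e : Plane) : scaledReflection (-z) e = scaledReflection z e := by
  simp [scaledReflection]

/-- Turning the mirror line by a right angle negates the reflection. This is the source of the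
cancellation of the singular kernel over discs. -/
lemma scaledReflection_rot (z e : Plane) : scaledReflection (rot z) e = -scaledReflection z e := by
  ext i
  fin_cases i <;>
  simp [scaledReflection, rot_apply, PiLp.inner_apply, Fin.sum_univ_two, EuclideanSpace.norm_sq_eq]
    <;> ring

lemma continuous_scaledReflection (e : Plane) : Continuous fun z => scaledReflection z e := by
  unfold scaledReflection; fun_prop

lemma hasLineDerivAt_smoothKernel {ε : ℝ} (hε : 0 < ε) (z e : Plane) :
    HasLineDerivAt ℝ (smoothKernel ε) (smoothKernelDeriv ε z e) z e := by
  have h1 : HasDerivAt (fun t : ℝ => z + t • e) e 0 := by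
    simpa using ((hasDerivAt_id (0 : ℝ)).smul_const e).const_add z
  have h2 : HasDerivAt (fun t : ℝ => ‖z + t • e‖ ^ 2 + ε ^ 2) (2 * inner ℝ z e) 0 := by
    simpa using h1.norm_sq.add_const (ε ^ 2)
  have hq : ‖z‖ ^ 2 + ε ^ 2 ≠ 0 := by positivity
  have h3 := (h2.fun_inv (by simpa using hq)).const_mul (1 / (2 * Real.pi))
  have h4 : HasDerivAt (fun t : ℝ => rot (z + t • e)) (rot e) 0 :=
    rot.toContinuousLinearEquiv.toContinuousLinearMap.hasFDerivAt.comp_hasDerivAt (0 : ℝ) h1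
  have h5 := h3.smul h4
  refine HasDerivAt.congr_deriv (f := fun t : ℝ => smoothKernel ε (z + t • e)) h5 ?_
  simp only [zero_smul, add_zero, smoothKernelDeriv, scaledReflection, map_sub, map_smul]
  -- The coefficient of `rot e` is divided between the bump and the reflection, so that the latter
  -- has exact cancellation.
  have e1 : ε ^ 2 / (‖z‖ ^ 2 + ε ^ 2) ^ 2 + ((‖z‖ ^ 2 + ε ^ 2) ^ 2)⁻¹ * ‖z‖ ^ 2 =
      (‖z‖ ^ 2 + ε ^ 2)⁻¹ := by field_simp; ring
  rw [← e1]
  module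

lemma continuous_smoothKernel {ε : ℝ} (hε : 0 < ε) : Continuous (smoothKernel ε) := by
  have hq : ∀ z : Plane, ‖z‖ ^ 2 + ε ^ 2 ≠ 0 := fun z => by positivity
  have := rot.continuous
  unfold smoothKernel
  fun_prop (disch := exact hq _)

lemma continuous_smoothKernelDeriv {ε : ℝ} (hε : 0 < ε) (e : Plane) :
    Continuous fun z => smoothKernelDeriv ε z e := by
  have hq : ∀ z : Plane, (‖z‖ ^ 2 + ε ^ 2) ^ 2 ≠ 0 := fun z => by positivity
  have := continuous_scaledReflection e
  have h : Continuous fun z : Plane => (ε ^ 2 / (‖z‖ ^ 2 + ε ^ 2) ^ 2) • e -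
      ((‖z‖ ^ 2 + ε ^ 2) ^ 2)⁻¹ • scaledReflection z e := by
    fun_prop (disch := exact hq _)
  have h2 : Continuous (rot : Plane → Plane) := rot.continuous
  exact (h2.comp h).const_smul (1 / (2 * Real.pi))

lemma norm_smoothKernel_le {ε : ℝ} (z : Plane) :
    ‖smoothKernel ε z‖ ≤ ‖biotSavartKernel z‖ := by
  rw [biotSavartKernel_eq, smoothKernel, norm_smul, norm_smul]
  rcases eq_or_ne z 0 with rfl | hz
  · simp
  · gcongr
    rw [Real.norm_of_nonneg (by positivity), Real.norm_of_nonneg (by positivity)]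
    have : 0 < ‖z‖ := norm_pos_iff.2 hz
    gcongr
    nlinarith [sq_nonneg ε]

lemma tendsto_smoothKernel {ε : ℕ → ℝ} (hε : Tendsto ε atTop (𝓝 0)) (z : Plane) :
    Tendsto (fun n => smoothKernel (ε n) z) atTop (𝓝 (biotSavartKernel z)) := by
  rcases eq_or_ne z 0 with rfl | hz
  · simp [smoothKernel, biotSavartKernel_eq]
  · rw [biotSavartKernel_eq]
    unfold smoothKernel
    have h1 : Tendsto (fun n => ‖z‖ ^ 2 + ε n ^ 2) atTop (𝓝 (‖z‖ ^ 2)) := by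
      simpa using (hε.pow 2).const_add (‖z‖ ^ 2)
    exact ((h1.inv₀ (by simpa using hz)).const_mul _).smul_const _

variable {w : Plane → ℝ}

/-- The velocity gradient as a limit of integrals against smooth kernels. -/
lemma tendsto_integral_smoothKernelDeriv (hw : ContDiff ℝ 1 w) (hc : HasCompactSupport w)
    (x e : Plane) {ε : ℕ → ℝ} (hε0 : ∀ n, 0 < ε n) (hε : Tendsto ε atTop (𝓝 0)) :
    Tendsto (fun n => ∫ z, w (x - z) • smoothKernelDeriv (ε n) z e) atTop
      (𝓝 (fderiv ℝ (biotSavart w) x e)) := by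
  have hcw : HasCompactSupport fun z => w (x - z) :=
    hc.comp_homeomorph (Homeomorph.subLeft x)
  have hcont : Continuous fun z => fderiv ℝ w (x - z) e :=
    ((hw.continuous_fderiv one_ne_zero).comp (continuous_const.sub continuous_id)).clm_apply
      continuous_const
  have hcw' : HasCompactSupport fun z => fderiv ℝ w (x - z) e :=
    (hc.fderiv_apply (𝕜 := ℝ) e).comp_homeomorph (Homeomorph.subLeft x)
  have hwx : Continuous fun z => w (x - z) := hw.continuous.comp (continuous_const.sub continuous_id)
  -- Integration by parts returns the derivative to `w`. What remains converges by domination, since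
  -- the smoothed kernel is bounded by the original one.
  have hibp : ∀ n, ∫ z, w (x - z) • smoothKernelDeriv (ε n) z e =
      ∫ z, fderiv ℝ w (x - z) e • smoothKernel (ε n) z := by
    intro n
    have := integral_bilinear_hasLineDerivAt_right_eq_neg_left_of_integrable (μ := volume)
      (B := ContinuousLinearMap.lsmul ℝ ℝ) (f := fun z => w (x - z))
      (f' := fun z => -(fderiv ℝ w (x - z) e)) (g := smoothKernel (ε n))
      (g' := fun z => smoothKernelDeriv (ε n) z e) (v := e) ?_ ?_ ?_ ?_ ?_
    · simpa [integral_neg] using this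
    · simp only [ContinuousLinearMap.lsmul_apply]
      exact (hcont.neg.smul (continuous_smoothKernel (hε0 n))).integrable_of_hasCompactSupport
        (hcw'.neg.smul_right)
    · simp only [ContinuousLinearMap.lsmul_apply]
      exact (hwx.smul (continuous_smoothKernelDeriv (hε0 n) e)).integrable_of_hasCompactSupport
        hcw.smul_right
    · simp only [ContinuousLinearMap.lsmul_apply]
      exact (hwx.smul (continuous_smoothKernel (hε0 n))).integrable_of_hasCompactSupport
        hcw.smul_right
    · intro z _
      have h1 : HasFDerivAt (fun z => w (x - z)) ((fderiv ℝ w (x - z)).comp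
          (-ContinuousLinearMap.id ℝ Plane)) z :=
        (hw.differentiable one_ne_zero (x - z)).hasFDerivAt.comp z
          ((hasFDerivAt_id z).const_sub x)
      simpa using h1.hasLineDerivAt e
    · intro z _
      exact hasLineDerivAt_smoothKernel (hε0 n) z e
  simp_rw [hibp]
  rw [fderiv_biotSavart_apply hw hc, biotSavart_eq_integral_sub]
  refine tendsto_integral_of_dominated_convergence
    (fun z => ‖fderiv ℝ w (x - z) e • biotSavartKernel z‖) (fun n => ?_) ?_ (fun n => ?_) ?_
  · exact (hcont.smul (continuous_smoothKernel (hε0 n))).aestronglyMeasurable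
  · exact (locallyIntegrable_biotSavartKernel.integrable_smul_left_of_hasCompactSupport
      hcont hcw').norm
  · refine Eventually.of_forall fun z => ?_
    rw [norm_smul, norm_smul]
    gcongr
    exact norm_smoothKernel_le z
  · exact Eventually.of_forall fun z => (tendsto_smoothKernel hε z).const_smul _

/-- The velocity is divergence free. -/
lemma sum_inner_fderiv_biotSavart (hw : ContDiff ℝ 1 w) (hc : HasCompactSupport w) (x : Plane) :
    ∑ i : Fin 2, fderiv ℝ (biotSavart w) x (EuclideanSpace.single i 1) i = 0 := by
  have hε0 : ∀ n : ℕ, 0 < 1 / ((n : ℝ) + 1) := fun n => by positivity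
  have h : ∀ i : Fin 2, Tendsto (fun n : ℕ => (∫ z, w (x - z) •
      smoothKernelDeriv (1 / ((n : ℝ) + 1)) z (EuclideanSpace.single i 1)) i) atTop
      (𝓝 (fderiv ℝ (biotSavart w) x (EuclideanSpace.single i 1) i)) := fun i =>
    ((EuclideanSpace.proj i : Plane →L[ℝ] ℝ).continuous.tendsto _).comp
      (tendsto_integral_smoothKernelDeriv hw hc x _ hε0 tendsto_one_div_add_atTop_nhds_zero_nat)
  refine tendsto_nhds_unique (tendsto_finsetSum Finset.univ fun i _ => h i) ?_
  -- The smoothed kernel is itself divergence free, being a rotated radial field, so the sequence is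
  -- identically zero.
  refine tendsto_const_nhds.congr fun n => ?_
  have hcw : HasCompactSupport fun z => w (x - z) :=
    hc.comp_homeomorph (Homeomorph.subLeft x)
  have hwx : Continuous fun z => w (x - z) := hw.continuous.comp (continuous_const.sub continuous_id)
  have hi : ∀ i : Fin 2, Integrable (fun z => w (x - z) •
      smoothKernelDeriv (1 / ((n : ℝ) + 1)) z (EuclideanSpace.single i 1)) := fun i =>
    (hwx.smul (continuous_smoothKernelDeriv (hε0 n) _)).integrable_of_hasCompactSupport
        hcw.smul_right
  have h2 : ∀ i : Fin 2, (∫ z, w (x - z) •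
      smoothKernelDeriv (1 / ((n : ℝ) + 1)) z (EuclideanSpace.single i 1)) i =
      ∫ z, (w (x - z) • smoothKernelDeriv (1 / ((n : ℝ) + 1)) z (EuclideanSpace.single i 1)) i :=
    fun i => ((EuclideanSpace.proj i : Plane →L[ℝ] ℝ).integral_comp_comm (hi i)).symm
  simp_rw [h2]
  have h3 : ∀ i : Fin 2, Integrable fun z => (w (x - z) •
      smoothKernelDeriv (1 / ((n : ℝ) + 1)) z (EuclideanSpace.single i 1)) i := fun i =>
    (EuclideanSpace.proj i : Plane →L[ℝ] ℝ).integrable_comp (hi i)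
  rw [Fin.sum_univ_two, ← integral_add (h3 0) (h3 1), eq_comm]
  refine integral_eq_zero_of_ae (Eventually.of_forall fun z => ?_)
  simp [smoothKernelDeriv, scaledReflection, rot_apply, PiLp.inner_apply]
  ring

/-- In polar coordinates the radial integrand has the primitive `-(ε²/2) (r² + ε²)⁻¹`. The mass does
not depend on `ε`, so the local part of the gradient is bounded by the supremum of the vorticity. -/
lemma integral_bump {ε : ℝ} (hε : 0 < ε) :
    Integrable (fun z : Plane => ε ^ 2 / (‖z‖ ^ 2 + ε ^ 2) ^ 2) ∧
    ∫ z : Plane, ε ^ 2 / (‖z‖ ^ 2 + ε ^ 2) ^ 2 = Real.pi := by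
  set f : ℝ → ℝ := fun r => ε ^ 2 / (r ^ 2 + ε ^ 2) ^ 2 with hf
  have hq : ∀ r : ℝ, r ^ 2 + ε ^ 2 ≠ 0 := fun r => by positivity
  have hder : ∀ r ∈ Ioi (0 : ℝ), HasDerivAt (fun r => -(ε ^ 2 / 2) * (r ^ 2 + ε ^ 2)⁻¹)
      (r ^ (2 - 1) • f r) r := by
    intro r _
    have h1 : HasDerivAt (fun r : ℝ => r ^ 2 + ε ^ 2) (2 * r) r := by
      simpa using (hasDerivAt_pow 2 r).add_const (ε ^ 2)
    refine ((h1.fun_inv (hq r)).const_mul (-(ε ^ 2 / 2))).congr_deriv ?_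
    simp only [hf, smul_eq_mul, pow_one, Nat.add_one_sub_one]
    have := hq r
    field_simp
  have hcont : ContinuousWithinAt (fun r : ℝ => -(ε ^ 2 / 2) * (r ^ 2 + ε ^ 2)⁻¹) (Ici 0) 0 := by
    apply Continuous.continuousWithinAt
    fun_prop (disch := exact hq _)
  have hpos : ∀ r ∈ Ioi (0 : ℝ), 0 ≤ r ^ (2 - 1) • f r := by
    intro r hr
    have : 0 < r := hr
    simp only [hf, smul_eq_mul]
    positivity
  have hlim : Tendsto (fun r : ℝ => -(ε ^ 2 / 2) * (r ^ 2 + ε ^ 2)⁻¹) atTop (𝓝 0) := by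
    have : Tendsto (fun r : ℝ => r ^ 2 + ε ^ 2) atTop atTop :=
      tendsto_atTop_add_const_right _ _ (tendsto_pow_atTop two_ne_zero)
    simpa using (tendsto_inv_atTop_zero.comp this).const_mul (-(ε ^ 2 / 2))
  have hI := integrableOn_Ioi_deriv_of_nonneg hcont hder hpos hlim
  have hE := integral_Ioi_of_hasDerivAt_of_nonneg hcont hder hpos hlim
  constructor
  · refine (integrable_fun_norm_addHaar volume (f := f)).2 ?_
    simpa using hI
  · have := integral_fun_norm_addHaar (E := Plane) volume f
    simp only [finrank_euclideanSpace, Fintype.card_fin] at this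
    rw [this, hE, measureReal_def, EuclideanSpace.volume_ball_fin_two]
    simp [ENNReal.toReal_ofReal Real.pi_pos.le]
    field_simp

end Regularised

/-! ### The integral of `|z|⁻²` over the region between a domain and its half-plane. -/

section Near

open ENNReal

/-- Coordinates along the orthonormal frame `(rot ν, ν)`. -/
def frame (ν : Plane) (hν : ‖ν‖ = 1) : Plane ≃ₗᵢ[ℝ] Plane :=
  LinearIsometry.toLinearIsometryEquiv
    { toFun := fun p => p 0 • rot ν + p 1 • ν
      map_add' := fun x y => by simp only [PiLp.add_apply]; module
      map_smul' := fun c x => by simp only [PiLp.smul_apply, smul_eq_mul, RingHom.id_apply]; module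
      norm_map' := fun x => by
        simp only [LinearMap.coe_mk, AddHom.coe_mk]
        rw [← sq_eq_sq₀ (norm_nonneg _) (norm_nonneg _), norm_add_sq_real, norm_smul, norm_smul,
          inner_smul_left, inner_smul_right, inner_rot_self, LinearIsometryEquiv.norm_map, hν,
          EuclideanSpace.norm_sq_eq, Fin.sum_univ_two]
        simp } rfl

lemma frame_apply {ν : Plane} (hν : ‖ν‖ = 1) (p : Plane) :
    frame ν hν p = p 0 • rot ν + p 1 • ν := rfl

lemma lintegral_frame {ν : Plane} (hν : ‖ν‖ = 1) {F : Plane → ℝ≥0∞} (hF : Measurable F) :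
    ∫⁻ z, F z = ∫⁻ b : ℝ, ∫⁻ a : ℝ, F (b • rot ν + a • ν) := by
  have h : MeasurePreserving
      (fun p : ℝ × ℝ => frame ν hν (WithLp.toLp 2 ((MeasurableEquiv.finTwoArrow).symm p)))
      volume volume :=
    (frame ν hν).measurePreserving.comp ((PiLp.volume_preserving_toLp (Fin 2)).comp
      (volume_preserving_finTwoArrow ℝ).symm)
  rw [← h.lintegral_comp hF, Measure.volume_eq_prod, lintegral_prod]
  · simp [frame_apply, MeasurableEquiv.finTwoArrow]
  · exact (hF.comp h.measurable).aemeasurable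

lemma inner_rot_frame {ν : Plane} (hν : ‖ν‖ = 1) (a b : ℝ) :
    inner ℝ (rot ν) (b • rot ν + a • ν) = b := by
  rw [inner_add_right, inner_smul_right, inner_smul_right, inner_rot_self,
    real_inner_self_eq_norm_sq, LinearIsometryEquiv.norm_map, hν]
  simp

lemma inner_frame {ν : Plane} (hν : ‖ν‖ = 1) (a b : ℝ) :
    inner ℝ ν (b • rot ν + a • ν) = a := by
  rw [inner_add_right, inner_smul_right, inner_smul_right, real_inner_comm, inner_rot_self,
    real_inner_self_eq_norm_sq, hν]
  simp

lemma norm_sq_eq_inner {ν : Plane} (hν : ‖ν‖ = 1) (z : Plane) :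
    ‖z‖ ^ 2 = inner ℝ ν z ^ 2 + inner ℝ (rot ν) z ^ 2 := by
  obtain ⟨p, rfl⟩ := (frame ν hν).surjective z
  rw [LinearIsometryEquiv.norm_map, frame_apply, inner_frame hν, inner_rot_frame hν,
    EuclideanSpace.norm_sq_eq, Fin.sum_univ_two]
  simp [add_comm]

/-- Fubini's theorem for a strip of variable width around a line. -/
lemma lintegral_strip {ν : Plane} (hν : ‖ν‖ = 1) {h k : ℝ → ℝ} (hh : Measurable h)
    (hk : Measurable k) :
    ∫⁻ z, {z : Plane | |inner ℝ ν z| ≤ h (inner ℝ (rot ν) z)}.indicator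
      (fun z => ENNReal.ofReal (k (inner ℝ (rot ν) z))) z =
    ∫⁻ b, ENNReal.ofReal (k b) * ENNReal.ofReal (2 * h b) := by
  have h1 : Measurable fun z : Plane => inner ℝ ν z := by fun_prop
  have h2 : Measurable fun z : Plane => inner ℝ (rot ν) z := by fun_prop
  rw [lintegral_frame hν]
  · congr 1
    ext1 b
    have : ∀ a : ℝ, {z : Plane | |inner ℝ ν z| ≤ h (inner ℝ (rot ν) z)}.indicator
      (fun z => ENNReal.ofReal (k (inner ℝ (rot ν) z))) (b • rot ν + a • ν) =
      (Icc (-h b) (h b)).indicator (fun _ => ENNReal.ofReal (k b)) a := by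
      intro a
      simp only [indicator, mem_ofPred_eq, inner_frame hν, inner_rot_frame hν, mem_Icc, abs_le]
    simp_rw [this]
    rw [lintegral_indicator measurableSet_Icc, lintegral_const, Measure.restrict_apply
      MeasurableSet.univ, univ_inter, Real.volume_Icc]
    congr 2
    ring
  · exact ((hk.comp h2).ennreal_ofReal).indicator
      (measurableSet_le (by fun_prop) (hh.comp h2))

/-- The contribution of the strip `|⟨ν, z⟩| ≤ 2d`: its width, proportional to `d`, cancels the
factor `1/d` of the Cauchy integral. -/
lemma lintegral_cauchy_le {d : ℝ} (hd : 0 ≤ d) :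
    ∫⁻ b : ℝ, ENNReal.ofReal (2 * (d ^ 2 + b ^ 2)⁻¹) * ENNReal.ofReal (2 * (2 * d)) ≤
      ENNReal.ofReal (8 * Real.pi) := by
  rcases hd.eq_or_lt with rfl | hd
  · simp
  have h1 : ∀ b : ℝ, ENNReal.ofReal (2 * (d ^ 2 + b ^ 2)⁻¹) * ENNReal.ofReal (2 * (2 * d)) =
      ENNReal.ofReal (8 / d * (1 + (b / d) ^ 2)⁻¹) := by
    intro b
    rw [← ENNReal.ofReal_mul (by positivity)]
    congr 1
    field_simp
    ring
  simp_rw [h1]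
  rw [← ofReal_integral_eq_lintegral_ofReal]
  · rw [integral_const_mul, Measure.integral_comp_div (fun x : ℝ => (1 + x ^ 2)⁻¹) d,
      integral_univ_inv_one_add_sq, abs_of_pos hd, smul_eq_mul]
    apply le_of_eq
    congr 1
    field_simp
  · exact (integrable_inv_one_add_sq.comp_div hd.ne').const_mul _
  · exact Eventually.of_forall fun b => by positivity

/-- The width of the cusp reduces `b⁻²` to `(64/D) |b| ^ (μ - 1)`, whose integral is `128 r ^ μ / (D
μ) = 8 / μ` by the choice of `r`. -/
lemma lintegral_cusp_le {μ D r : ℝ} (hμ₀ : 0 < μ) (hμ₁ : μ < 1) (hD : 0 < D) (hr : 0 < r)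
    (hrD : r ^ μ = D / 16) :
    ∫⁻ b : ℝ, ENNReal.ofReal ((Iio r).indicator (fun _ => (b ^ 2)⁻¹) |b|) *
      ENNReal.ofReal (2 * (32 * |b| ^ (1 + μ) / D)) ≤ ENNReal.ofReal (8 / μ) := by
  set f : ℝ → ℝ := (Iio r).indicator (fun x => 64 / D * x ^ (μ - 1)) with hf
  have h1 : ∀ b : ℝ, ENNReal.ofReal ((Iio r).indicator (fun _ => (b ^ 2)⁻¹) |b|) *
      ENNReal.ofReal (2 * (32 * |b| ^ (1 + μ) / D)) = ENNReal.ofReal (f ‖b‖) := by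
    intro b
    rw [← ENNReal.ofReal_mul (indicator_nonneg (fun _ _ => by positivity) _), Real.norm_eq_abs, hf]
    congr 1
    by_cases hb : |b| ∈ Iio r
    · rw [indicator_of_mem hb, indicator_of_mem hb]
      rcases eq_or_ne b 0 with rfl | hb0
      · simp [Real.zero_rpow, (by linarith : μ - 1 ≠ 0)]
      · have hb' : 0 < |b| := abs_pos.2 hb0
        rw [← sq_abs b, Real.rpow_add hb', Real.rpow_sub hb', Real.rpow_one]
        field_simp
        norm_num
    · simp [indicator_of_notMem hb]
  have hint : IntervalIntegrable (fun x : ℝ => x ^ (μ - 1)) volume 0 r :=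
    intervalIntegral.intervalIntegrable_rpow' (by linarith)
  have hIoo : IntegrableOn (fun x : ℝ => 64 / D * x ^ (μ - 1)) (Ioo 0 r) volume := by
    rw [← integrableOn_Ioc_iff_integrableOn_Ioo]
    exact ((intervalIntegrable_iff_integrableOn_Ioc_of_le hr.le).1 hint).const_mul _
  have hset : Ioi (0 : ℝ) ∩ Iio r = Ioo 0 r := Ioi_inter_Iio
  simp_rw [h1]
  rw [← ofReal_integral_eq_lintegral_ofReal]
  · rw [integral_fun_norm_addHaar volume f]
    simp only [Module.finrank_self, Nat.sub_self, pow_zero, one_smul]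
    rw [hf, setIntegral_indicator measurableSet_Iio, hset, ← integral_Ioc_eq_integral_Ioo,
      ← intervalIntegral.integral_of_le hr.le, intervalIntegral.integral_const_mul,
      integral_rpow (Or.inl (by linarith))]
    apply ENNReal.ofReal_le_ofReal
    apply le_of_eq
    rw [Real.zero_rpow (by linarith), show μ - 1 + 1 = μ by ring, hrD, measureReal_def,
      Real.volume_ball, ENNReal.toReal_ofReal (by norm_num)]
    simp only [smul_eq_mul]
    field_simp
    ring
  · rw [integrable_fun_norm_addHaar volume (f := f)]
    simp only [Module.finrank_self, Nat.sub_self, pow_zero, one_smul]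
    rw [hf, IntegrableOn, integrable_indicator_iff measurableSet_Iio, IntegrableOn,
      Measure.restrict_restrict measurableSet_Iio, inter_comm, hset]
    exact hIoo
  · exact Eventually.of_forall fun b => indicator_apply_nonneg fun _ => by positivity

/-- The region, outside the disc of radius `d`, where a `C^{1,μ}` domain and its half-plane
approximation may differ. -/
def errorRegion (μ D r d : ℝ) (ν : Plane) : Set Plane :=
  {z | d ≤ ‖z‖ ∧ ‖z‖ < r ∧ |inner ℝ ν z| ≤ d + 4 * ‖z‖ ^ (1 + μ) / D}

/-- At each point one of the two terms of the width dominates. The point then lies either in the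
strip of half-width `2d` or in a cusp, and in both cases `‖z‖⁻²` is dominated by a function of the
coordinate along the line, so Fubini's theorem applies. -/
lemma lintegral_errorRegion_le {μ D r d : ℝ} (hμ₀ : 0 < μ) (hμ₁ : μ < 1) (hD : 0 < D) (hr : 0 < r)
    (hrD : r ^ μ = D / 16) (hd : 0 ≤ d) {ν : Plane} (hν : ‖ν‖ = 1) :
    ∫⁻ z, (errorRegion μ D r d ν).indicator (fun z => ENNReal.ofReal (‖z‖ ^ 2)⁻¹) z ≤
      ENNReal.ofReal (8 * Real.pi + 8 / μ) := by
  set k₁ : ℝ → ℝ := fun b => 2 * (d ^ 2 + b ^ 2)⁻¹ with hk₁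
  set k₂ : ℝ → ℝ := fun b => (Iio r).indicator (fun _ => (b ^ 2)⁻¹) |b| with hk₂
  set h₂ : ℝ → ℝ := fun b => 32 * |b| ^ (1 + μ) / D with hh₂
  have mk₁ : Measurable k₁ := by fun_prop
  have mk₂ : Measurable k₂ := by
    have : k₂ = {b : ℝ | |b| < r}.indicator (fun b => (b ^ 2)⁻¹) := by
      ext b; simp [hk₂, indicator]
    rw [this]
    exact Measurable.indicator (by fun_prop) (measurableSet_lt (by fun_prop) measurable_const)
  have mh₂ : Measurable h₂ := by fun_prop
  set F₁ := {z : Plane | |inner ℝ ν z| ≤ 2 * d}.indicator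
      (fun z => ENNReal.ofReal (k₁ (inner ℝ (rot ν) z))) with hF₁
  set F₂ := {z : Plane | |inner ℝ ν z| ≤ h₂ (inner ℝ (rot ν) z)}.indicator
      (fun z => ENNReal.ofReal (k₂ (inner ℝ (rot ν) z))) with hF₂
  have mF₁ : Measurable F₁ := Measurable.indicator (by fun_prop)
    (measurableSet_le (by fun_prop) measurable_const)
  have key : ∀ z, (errorRegion μ D r d ν).indicator (fun z => ENNReal.ofReal (‖z‖ ^ 2)⁻¹) z ≤
      F₁ z + F₂ z := by
    intro z
    by_cases hz : z ∈ errorRegion μ D r d ν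
    swap
    · rw [indicator_of_notMem hz]; exact zero_le
    rw [indicator_of_mem hz]
    obtain ⟨hz1, hz2, hz3⟩ := hz
    rcases eq_or_ne z 0 with rfl | hz0
    · simp
    have hzp : 0 < ‖z‖ := norm_pos_iff.2 hz0
    have hsq := norm_sq_eq_inner hν z
    set a := inner ℝ ν z with ha
    set b := inner ℝ (rot ν) z with hb
    have hpow : 0 < ‖z‖ ^ (1 + μ) := by positivity
    rcases le_total (4 * ‖z‖ ^ (1 + μ) / D) d with hcase | hcase
    · have hd' : 0 < d := lt_of_lt_of_le (by positivity) hcase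
      have hmem : z ∈ {z : Plane | |inner ℝ ν z| ≤ 2 * d} := by
        simp only [mem_ofPred_eq]; linarith
      rw [hF₁, indicator_of_mem hmem]
      refine le_trans (ENNReal.ofReal_le_ofReal ?_) le_self_add
      rw [hk₁]
      simp only
      rw [← hb]
      have h1 : d ^ 2 + b ^ 2 ≤ 2 * ‖z‖ ^ 2 := by nlinarith [sq_nonneg a]
      rw [← div_eq_mul_inv, inv_eq_one_div, div_le_div_iff₀ (by positivity) (by positivity)]
      linarith
    · have hzμ : ‖z‖ ^ μ ≤ D / 16 := by
        rw [← hrD]; gcongr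
      have hA : |a| ≤ 8 * ‖z‖ ^ (1 + μ) / D := by
        have : 8 * ‖z‖ ^ (1 + μ) / D = 4 * ‖z‖ ^ (1 + μ) / D + 4 * ‖z‖ ^ (1 + μ) / D := by ring
        linarith
      -- Here the factor `16` in `r ^ μ = D / 16` is used: the normal component is at most half of
      -- `‖z‖`, so the tangential one is comparable to `‖z‖`.
      have hB : 8 * ‖z‖ ^ (1 + μ) / D ≤ ‖z‖ / 2 := by
        rw [Real.rpow_add hzp, Real.rpow_one, div_le_iff₀ hD]
        nlinarith
      have ha2 : a ^ 2 ≤ (‖z‖ / 2) ^ 2 := sq_le_sq' (by linarith [neg_abs_le a])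
        (by linarith [le_abs_self a])
      have hbz : ‖z‖ ≤ 2 * |b| := by
        rw [← sq_le_sq₀ hzp.le (by positivity), mul_pow, sq_abs]
        nlinarith
      have hbz' : |b| ≤ ‖z‖ := by
        rw [← sq_le_sq₀ (by positivity) hzp.le, sq_abs]
        nlinarith [sq_nonneg a]
      have hb0 : 0 < |b| := by linarith
      have hpw : ‖z‖ ^ (1 + μ) ≤ 4 * |b| ^ (1 + μ) := by
        calc ‖z‖ ^ (1 + μ) ≤ (2 * |b|) ^ (1 + μ) := by gcongr
          _ = 2 ^ (1 + μ) * |b| ^ (1 + μ) := Real.mul_rpow (by norm_num) hb0.le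
          _ ≤ 4 * |b| ^ (1 + μ) := by
            gcongr
            calc (2 : ℝ) ^ (1 + μ) ≤ 2 ^ (2 : ℝ) := by
                  gcongr
                  · norm_num
                  · linarith
              _ = 4 := by norm_num
      have hmem : z ∈ {z : Plane | |inner ℝ ν z| ≤ h₂ (inner ℝ (rot ν) z)} := by
        simp only [mem_ofPred_eq, hh₂, ← ha, ← hb]
        refine hA.trans ?_
        gcongr ?_ / D
        linarith
      rw [hF₂, indicator_of_mem hmem]
      refine le_trans (ENNReal.ofReal_le_ofReal ?_) le_add_self
      have hbr : |b| ∈ Iio r := lt_of_le_of_lt hbz' hz2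
      simp only [hk₂, ← hb]
      rw [indicator_of_mem hbr, ← sq_abs b]
      gcongr
  calc _ ≤ ∫⁻ z, F₁ z + F₂ z := lintegral_mono key
    _ = (∫⁻ z, F₁ z) + ∫⁻ z, F₂ z := lintegral_add_left mF₁ _
    _ ≤ ENNReal.ofReal (8 * Real.pi) + ENNReal.ofReal (8 / μ) := by
      refine add_le_add ?_ ?_
      · rw [hF₁, lintegral_strip (h := fun _ => 2 * d) hν measurable_const mk₁]
        exact lintegral_cauchy_le hd
      · rw [hF₂, lintegral_strip hν mh₂ mk₂]
        exact lintegral_cusp_le hμ₀ hμ₁ hD hr hrD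
    _ = _ := (ENNReal.ofReal_add (by positivity) (by positivity)).symm

end Near

/-! ### Cancellation of the kernel over superlevel sets. -/

section Near

open ENNReal

variable {F : Type*} [NormedAddCommGroup F] [NormedSpace ℝ F]

/-- A continuous kernel with the symmetries and the size of a regularised Calderón-Zygmund
kernel. -/
structure IsStressKernel (c : ℝ) (g : Plane → F) : Prop where
  nonneg : 0 ≤ c
  continuous : Continuous g
  neg : ∀ z, g (-z) = g z
  map_rot : ∀ z, g (rot z) = -g z
  norm_le : ∀ z, ‖g z‖ ≤ c * (‖z‖ ^ 2)⁻¹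

lemma isStressKernel_scaledReflection {ε : ℝ} (hε : 0 < ε) (e : Plane) :
    IsStressKernel ‖e‖ (fun z => ((‖z‖ ^ 2 + ε ^ 2) ^ 2)⁻¹ • scaledReflection z e) where
  nonneg := norm_nonneg _
  continuous := by
    have hq : ∀ z : Plane, (‖z‖ ^ 2 + ε ^ 2) ^ 2 ≠ 0 := fun z => by positivity
    have := continuous_scaledReflection e
    fun_prop (disch := exact hq _)
  neg z := by rw [norm_neg, scaledReflection_neg]
  map_rot z := by rw [LinearIsometryEquiv.norm_map, scaledReflection_rot, smul_neg]
  norm_le z := by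
    rw [norm_smul, norm_scaledReflection, Real.norm_of_nonneg (by positivity)]
    rcases eq_or_ne z 0 with rfl | hz
    · simp
    have hz : 0 < ‖z‖ := norm_pos_iff.2 hz
    have h : (‖z‖ ^ 2) ^ 2 ≤ (‖z‖ ^ 2 + ε ^ 2) ^ 2 := by
      gcongr
      nlinarith [sq_nonneg ε]
    calc ((‖z‖ ^ 2 + ε ^ 2) ^ 2)⁻¹ * (‖z‖ ^ 2 * ‖e‖) ≤ ((‖z‖ ^ 2) ^ 2)⁻¹ * (‖z‖ ^ 2 * ‖e‖) := by
          gcongr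
      _ = ‖e‖ * (‖z‖ ^ 2)⁻¹ := by field_simp

/-- A set invariant under rotations about the origin. -/
def IsRadial (S : Set Plane) : Prop := ∃ U : Set ℝ, S = norm ⁻¹' U

lemma isRadial_ball (r : ℝ) : IsRadial (Metric.ball (0 : Plane) r) :=
  ⟨Iio r, by ext z; simp⟩

lemma IsRadial.diff {S S' : Set Plane} (h : IsRadial S) (h' : IsRadial S') : IsRadial (S \ S') := by
  obtain ⟨U, rfl⟩ := h
  obtain ⟨U', rfl⟩ := h'
  exact ⟨U \ U', rfl⟩

variable {c : ℝ} {g : Plane → F}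

lemma eq_zero_of_neg_eq_self {x : F} (h : -x = x) : x = 0 := by
  have h2 : (2 : ℝ) • x = 0 := by
    rw [two_smul]
    nth_rewrite 1 [← h]
    exact neg_add_cancel x
  simpa using h2

/-- A quarter turn preserves `S` and negates `g`, so the integral equals its own negative. -/
lemma IsStressKernel.setIntegral_eq_zero (hg : IsStressKernel c g) {S : Set Plane}
    (hS : IsRadial S) (hm : MeasurableSet S) : ∫ z in S, g z = 0 := by
  obtain ⟨U, rfl⟩ := hS
  rw [← integral_indicator hm]
  have h := rot.measurePreserving.integral_comp rot.toHomeomorph.measurableEmbedding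
    ((norm ⁻¹' U).indicator g)
  have h2 : ∀ z : Plane, (norm ⁻¹' U).indicator g (rot z) = -(norm ⁻¹' U).indicator g z := by
    intro z
    by_cases hz : ‖z‖ ∈ U
    · rw [indicator_of_mem (by simpa using hz), indicator_of_mem (by simpa using hz), hg.map_rot]
    · rw [indicator_of_notMem (by simpa using hz), indicator_of_notMem (by simpa using hz),
        neg_zero]
  simp_rw [h2, integral_neg] at h
  exact eq_zero_of_neg_eq_self h

open Classical in
/-- The sign of the component along `ν`. -/
def halfSign (ν z : Plane) : ℝ := if 0 < inner ℝ ν z then 1 else if inner ℝ ν z < 0 then -1 else 0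

lemma measurable_halfSign (ν : Plane) : Measurable (halfSign ν) :=
  Measurable.ite (measurableSet_lt measurable_const (by fun_prop)) measurable_const
    (Measurable.ite (measurableSet_lt (by fun_prop) measurable_const) measurable_const
      measurable_const)

lemma halfSign_neg (ν z : Plane) : halfSign ν (-z) = -halfSign ν z := by
  unfold halfSign
  rw [inner_neg_right]
  split_ifs <;> linarith

lemma abs_halfSign_le (ν z : Plane) : |halfSign ν z| ≤ 1 := by
  unfold halfSign
  split_ifs <;> simp

/-- The kernel is even, the sign is odd, and `S` is symmetric. -/
lemma IsStressKernel.setIntegral_halfSign_eq_zero (hg : IsStressKernel c g) (ν : Plane)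
    {S : Set Plane} (hS : IsRadial S) (hm : MeasurableSet S) :
    ∫ z in S, halfSign ν z • g z = 0 := by
  obtain ⟨U, rfl⟩ := hS
  rw [← integral_indicator hm]
  have h := integral_neg_eq_self ((norm ⁻¹' U).indicator fun z => halfSign ν z • g z) volume
  have h2 : ∀ z : Plane, (norm ⁻¹' U).indicator (fun z => halfSign ν z • g z) (-z) =
      -(norm ⁻¹' U).indicator (fun z => halfSign ν z • g z) z := by
    intro z
    by_cases hz : ‖z‖ ∈ U
    · rw [indicator_of_mem (by simpa using hz), indicator_of_mem (by simpa using hz), hg.neg,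
        halfSign_neg, neg_smul]
    · rw [indicator_of_notMem (by simpa using hz), indicator_of_notMem (by simpa using hz),
        neg_zero]
  simp_rw [h2, integral_neg] at h
  exact eq_zero_of_neg_eq_self h

lemma IsStressKernel.integrableOn {F : Type*} [NormedAddCommGroup F] {g : Plane → F}
    (hg : IsStressKernel c g) {S : Set Plane} (r : ℝ)
    (hS : S ⊆ Metric.ball 0 r) : IntegrableOn g S volume :=
  (hg.continuous.continuousOn.integrableOn_compact (isCompact_closedBall 0 r)).mono_set
    (hS.trans Metric.ball_subset_closedBall)

/-- If a set agrees with a half-plane off the error region, then the integral of the kernel over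
the part of the set in an annulus is bounded. -/
lemma IsStressKernel.norm_setIntegral_indicator_le (hg : IsStressKernel c g)
    {μ D r d : ℝ} (hμ₀ : 0 < μ) (hμ₁ : μ < 1) (hD : 0 < D) (hr : 0 < r)
    (hrD : r ^ μ = D / 16) (hd : 0 ≤ d) {ν : Plane} (hν : ‖ν‖ = 1) {A : Set Plane}
    (hA : MeasurableSet A)
    (hpos : ∀ z, d ≤ ‖z‖ → ‖z‖ < r → d + 4 * ‖z‖ ^ (1 + μ) / D < inner ℝ ν z → z ∈ A)
    (hneg : ∀ z, d ≤ ‖z‖ → ‖z‖ < r → inner ℝ ν z < -(d + 4 * ‖z‖ ^ (1 + μ) / D) → z ∉ A) :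
    ‖∫ z in Metric.ball 0 r \ Metric.ball 0 d, A.indicator g z‖ ≤
      c * (8 * Real.pi + 8 / μ) := by
  set S : Set Plane := Metric.ball 0 r \ Metric.ball 0 d with hS
  have hSm : MeasurableSet S := measurableSet_ball.diff measurableSet_ball
  have hSr : IsRadial S := (isRadial_ball r).diff (isRadial_ball d)
  have hgS : IntegrableOn g S volume := hg.integrableOn r sdiff_subset
  have hc := hg.nonneg
  -- This is `g` restricted to the half-plane `⟨ν, z⟩ > 0`, with weight `1/2` on its boundary. Its
  -- integral vanishes by the two symmetries, so subtracting it changes nothing and leaves an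
  -- integrand supported in the error region.
  set f : Plane → F := fun z => (1 / 2 : ℝ) • (g z + halfSign ν z • g z) with hf
  have hsg : IntegrableOn (fun z => halfSign ν z • g z) S volume :=
    hgS.bdd_smul 1 (measurable_halfSign ν).aestronglyMeasurable
      (Eventually.of_forall fun z => abs_halfSign_le ν z)
  have hfS : IntegrableOn f S volume := (hgS.add hsg).smul (1 / 2 : ℝ)
  have hf0 : ∫ z in S, f z = 0 := by
    rw [hf, integral_smul, integral_add hgS hsg, hg.setIntegral_eq_zero hSr hSm,
      hg.setIntegral_halfSign_eq_zero ν hSr hSm]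
    simp
  have hAS : IntegrableOn (A.indicator g) S volume := hgS.indicator hA
  have h1 : ∫ z in S, A.indicator g z = ∫ z in S, (A.indicator g z - f z) := by
    rw [integral_sub hAS hfS, hf0, sub_zero]
  rw [h1]
  refine (norm_integral_le_lintegral_norm _).trans ?_
  refine ENNReal.toReal_le_of_le_ofReal (by positivity) ?_
  rw [← lintegral_indicator hSm]
  have hle : ∀ z, S.indicator (fun z => ENNReal.ofReal ‖A.indicator g z - f z‖) z ≤
      ENNReal.ofReal c *
        (errorRegion μ D r d ν).indicator (fun z => ENNReal.ofReal (‖z‖ ^ 2)⁻¹) z := by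
    intro z
    by_cases hz : z ∈ S
    swap
    · rw [indicator_of_notMem hz]; exact zero_le
    rw [indicator_of_mem hz]
    have hzr : ‖z‖ < r := by simpa using hz.1
    have hzd : d ≤ ‖z‖ := by simpa using hz.2
    have hw : 0 ≤ 4 * ‖z‖ ^ (1 + μ) / D := by positivity
    by_cases hE : z ∈ errorRegion μ D r d ν
    · rw [indicator_of_mem hE, ← ENNReal.ofReal_mul hc]
      apply ENNReal.ofReal_le_ofReal
      refine le_trans ?_ (hg.norm_le z)
      have hs := abs_le.1 (abs_halfSign_le ν z)
      have : A.indicator g z - f z =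
          ((A.indicator (fun _ => (1 : ℝ)) z) - (1 / 2) * (1 + halfSign ν z)) • g z := by
        rw [hf]
        by_cases hzA : z ∈ A
        · rw [indicator_of_mem hzA, indicator_of_mem hzA]; module
        · rw [indicator_of_notMem hzA, indicator_of_notMem hzA]; module
      rw [this, norm_smul]
      refine mul_le_of_le_one_left (norm_nonneg _) ?_
      rw [Real.norm_eq_abs, abs_le]
      by_cases hzA : z ∈ A
      · rw [indicator_of_mem hzA]; constructor <;> linarith
      · rw [indicator_of_notMem hzA]; constructor <;> linarith
    · have hgt : d + 4 * ‖z‖ ^ (1 + μ) / D < |inner ℝ ν z| := by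
        by_contra hcon
        exact hE ⟨hzd, hzr, not_lt.1 hcon⟩
      have h0 : A.indicator g z - f z = 0 := by
        rcases lt_abs.1 hgt with h | h
        · rw [indicator_of_mem (hpos z hzd hzr h), hf]
          have : halfSign ν z = 1 := by
            unfold halfSign; rw [if_pos (by linarith)]
          simp only [this]
          module
        · rw [indicator_of_notMem (hneg z hzd hzr (by linarith)), hf]
          have : halfSign ν z = -1 := by
            unfold halfSign; rw [if_neg (by linarith), if_pos (by linarith)]
          simp only [this]
          module
      rw [h0]
      simp
  calc _ ≤ ∫⁻ z, ENNReal.ofReal c *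
        (errorRegion μ D r d ν).indicator (fun z => ENNReal.ofReal (‖z‖ ^ 2)⁻¹) z :=
        lintegral_mono hle
    _ = ENNReal.ofReal c * ∫⁻ z,
        (errorRegion μ D r d ν).indicator (fun z => ENNReal.ofReal (‖z‖ ^ 2)⁻¹) z :=
        lintegral_const_mul' _ _ ENNReal.ofReal_ne_top
    _ ≤ ENNReal.ofReal c * ENNReal.ofReal (8 * Real.pi + 8 / μ) := by
        gcongr
        exact lintegral_errorRegion_le hμ₀ hμ₁ hD hr hrD hd hν
    _ = _ := (ENNReal.ofReal_mul hc).symm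

/-- The integral of the kernel over a superlevel set in a disc whose radius is controlled by
the regularity of the level set is bounded by a constant depending on `μ` only. -/
theorem IsStressKernel.norm_setIntegral_superlevel_le (hg : IsStressKernel c g)
    {μ m H r s : ℝ} (hμ₀ : 0 < μ) (hμ₁ : μ < 1) (hm : 0 < m) (hH : 0 < H) (hr : 0 < r)
    (hrD : r ^ μ = m / H / 16) {ψ : Plane → ℝ} (hψ : Differentiable ℝ ψ)
    (hlow : ∀ z, ψ z = s → m ≤ ‖fderiv ℝ ψ z‖)
    (hhol : ∀ x y, ‖fderiv ℝ ψ x - fderiv ℝ ψ y‖ ≤ H * ‖x - y‖ ^ μ) :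
    ‖∫ z in Metric.ball 0 r, {z | s ≤ ψ z}.indicator g z‖ ≤ c * (8 * Real.pi + 8 / μ) := by
  have hc := hg.nonneg
  have hψc := hψ.continuous
  set A : Set Plane := {z | s ≤ ψ z} with hA
  have hAm : MeasurableSet A := (isClosed_le continuous_const hψc).measurableSet
  -- By the intermediate value theorem a disc that misses the level set lies inside or outside the
  -- superlevel set, and the kernel integrates to zero over a full disc.
  have hball : ∀ q, (∀ z ∈ Metric.ball (0 : Plane) q, ψ z ≠ s) →
      ∫ z in Metric.ball 0 q, A.indicator g z = 0 := by
    intro q hq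
    have hcon : (∀ z ∈ Metric.ball (0 : Plane) q, z ∈ A) ∨
        (∀ z ∈ Metric.ball (0 : Plane) q, z ∉ A) := by
      by_contra! hcon
      obtain ⟨⟨z₁, hz₁, h₁⟩, z₂, hz₂, h₂⟩ := hcon
      obtain ⟨z, hz, hzs⟩ := (convex_ball (0 : Plane) q).isPreconnected.intermediate_value hz₁ hz₂
        hψc.continuousOn (show s ∈ Icc (ψ z₁) (ψ z₂) from ⟨(not_le.1 h₁).le, h₂⟩)
      exact hq z hz hzs
    rcases hcon with h | h
    · rw [setIntegral_congr_fun measurableSet_ball (fun z hz => indicator_of_mem (h z hz) g)]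
      exact hg.setIntegral_eq_zero (isRadial_ball q) measurableSet_ball
    · rw [setIntegral_congr_fun measurableSet_ball (fun z hz => indicator_of_notMem (h z hz) g)]
      simp
  by_cases hex : ∀ z ∈ Metric.ball (0 : Plane) r, ψ z ≠ s
  · rw [hball r hex, norm_zero]
    positivity
  push Not at hex
  obtain ⟨z₀, hz₀, hz₀s⟩ := hex
  have hclosed : IsClosed {z | ψ z = s} := isClosed_eq hψc continuous_const
  -- The half-plane is normal to the gradient at the point `p` of the level set nearest to the
  -- centre, but its boundary passes through the centre. The shift `⟨ν, p⟩`, at most `d = ‖p‖`,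
  -- accounts for the term `d` in the error region.
  obtain ⟨p, hp, hpd⟩ := hclosed.exists_infDist_eq_dist ⟨z₀, hz₀s⟩ 0
  have hmin : ∀ z, ψ z = s → ‖p‖ ≤ ‖z‖ := by
    intro z hz
    have := Metric.infDist_le_dist_of_mem (x := 0) (show z ∈ {z | ψ z = s} from hz)
    rwa [hpd, dist_zero_left, dist_zero_left] at this
  have hps : ψ p = s := hp
  set d := ‖p‖ with hd
  have hdr : d < r := (hmin z₀ hz₀s).trans_lt (by simpa using hz₀)
  have hG : m ≤ ‖∇ ψ p‖ := by
    rw [gradient, LinearIsometryEquiv.norm_map]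
    exact hlow p hps
  have hG0 : 0 < ‖∇ ψ p‖ := hm.trans_le hG
  set ν : Plane := ‖∇ ψ p‖⁻¹ • ∇ ψ p with hν
  have hν1 : ‖ν‖ = 1 := by
    rw [hν, norm_smul, norm_inv, norm_norm, inv_mul_cancel₀ hG0.ne']
  have hfd : ∀ z, fderiv ℝ ψ p z = ‖∇ ψ p‖ * inner ℝ ν z := by
    intro z
    rw [hν, real_inner_smul_left, ← mul_assoc, mul_inv_cancel₀ hG0.ne', one_mul, gradient,
      InnerProductSpace.toDual_symm_apply]
  have hνp : |inner ℝ ν p| ≤ d := by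
    have := abs_real_inner_le_norm ν p
    rwa [hν1, one_mul] at this
  -- Taylor expansion at `p`. Outside the disc of radius `d`, `‖z - p‖ ≤ 2 ‖z‖`, and `2 ^ (1 + μ) ≤
  -- 4`.
  have htaylor : ∀ z, d ≤ ‖z‖ →
      |ψ z - s - ‖∇ ψ p‖ * (inner ℝ ν z - inner ℝ ν p)| ≤ H * (4 * ‖z‖ ^ (1 + μ)) := by
    intro z hz
    have := norm_sub_sub_fderiv_le hμ₀ hH.le hψ hhol p z
    rw [hps, hfd, inner_sub_right, Real.norm_eq_abs] at this
    refine this.trans ?_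
    gcongr
    calc ‖z - p‖ ^ (1 + μ) ≤ (2 * ‖z‖) ^ (1 + μ) := by
          gcongr
          exact (norm_sub_le _ _).trans (by linarith)
      _ = 2 ^ (1 + μ) * ‖z‖ ^ (1 + μ) := Real.mul_rpow (by norm_num) (norm_nonneg _)
      _ ≤ 4 * ‖z‖ ^ (1 + μ) := by
          gcongr
          calc (2 : ℝ) ^ (1 + μ) ≤ 2 ^ (2 : ℝ) := by
                gcongr
                · norm_num
                · linarith
            _ = 4 := by norm_num
  have herr : ∀ z : Plane, H * (4 * ‖z‖ ^ (1 + μ)) ≤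
      ‖∇ ψ p‖ * (4 * ‖z‖ ^ (1 + μ) / (m / H)) := by
    intro z
    have : H * (4 * ‖z‖ ^ (1 + μ)) = m * (4 * ‖z‖ ^ (1 + μ) / (m / H)) := by field_simp
    rw [this]
    gcongr
  have hsplit : Metric.ball (0 : Plane) r = Metric.ball 0 d ∪ (Metric.ball 0 r \ Metric.ball 0 d) :=
    (union_sdiff_cancel (Metric.ball_subset_ball hdr.le)).symm
  have hint : ∀ S ⊆ Metric.ball (0 : Plane) r, IntegrableOn (A.indicator g) S volume := fun S hS =>
    (hg.integrableOn r hS).indicator hAm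
  rw [hsplit, setIntegral_union disjoint_sdiff_right (measurableSet_ball.diff measurableSet_ball)
    (hint _ (Metric.ball_subset_ball hdr.le)) (hint _ sdiff_subset), hball d, zero_add]
  · refine hg.norm_setIntegral_indicator_le hμ₀ hμ₁ (div_pos hm hH) hr hrD (norm_nonneg _) hν1
      hAm (fun z hz hzr h => ?_) (fun z hz hzr h => ?_)
    · have h1 := (abs_le.1 (htaylor z hz)).1
      have h2 := herr z
      have h3 : ‖∇ ψ p‖ * (4 * ‖z‖ ^ (1 + μ) / (m / H)) <
          ‖∇ ψ p‖ * (inner ℝ ν z - inner ℝ ν p) := by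
        gcongr
        linarith [(abs_le.1 hνp).2]
      change s ≤ ψ z
      linarith
    · have h1 := (abs_le.1 (htaylor z hz)).2
      have h2 := herr z
      have h3 : ‖∇ ψ p‖ * (4 * ‖z‖ ^ (1 + μ) / (m / H)) <
          ‖∇ ψ p‖ * (-(inner ℝ ν z - inner ℝ ν p)) := by
        gcongr
        linarith [(abs_le.1 hνp).1]
      change ¬ s ≤ ψ z
      rw [not_le]
      linarith
  · intro z hz hzs
    have := hmin z hzs
    have h2 : ‖z‖ < d := by simpa using hz
    linarith

end Near

/-! ### The contribution of distant vorticity. -/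

section Far

lemma integral_annulus {r R : ℝ} (hr : 0 < r) (hR : r ≤ R) :
    Integrable (fun z : Plane => (Ico r R).indicator (fun t => (t ^ 2)⁻¹) ‖z‖) ∧
    ∫ z : Plane, (Ico r R).indicator (fun t => (t ^ 2)⁻¹) ‖z‖ = 2 * Real.pi * Real.log (R / r) := by
  set f : ℝ → ℝ := (Ico r R).indicator (fun t => (t ^ 2)⁻¹) with hf
  have h1 : ∀ y : ℝ, y ^ (2 - 1) • f y = (Ico r R).indicator (fun t => t⁻¹) y := by
    intro y
    rw [hf]
    by_cases hy : y ∈ Ico r R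
    · have : 0 < y := hr.trans_le hy.1
      rw [indicator_of_mem hy, indicator_of_mem hy]
      simp only [Nat.add_one_sub_one, pow_one, smul_eq_mul]
      field_simp
    · rw [indicator_of_notMem hy, indicator_of_notMem hy, smul_zero]
  have hset : Ioi (0 : ℝ) ∩ Ico r R = Ico r R :=
    inter_eq_right.2 fun y hy => hr.trans_le hy.1
  have h0 : (0 : ℝ) ∉ uIcc r R := notMem_uIcc_of_lt hr (hr.trans_le hR)
  constructor
  · rw [integrable_fun_norm_addHaar volume (f := f)]
    simp only [finrank_euclideanSpace, Fintype.card_fin]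
    simp_rw [h1]
    rw [IntegrableOn, integrable_indicator_iff measurableSet_Ico, IntegrableOn,
      Measure.restrict_restrict measurableSet_Ico, inter_comm, hset]
    have : IntervalIntegrable (fun t : ℝ => t⁻¹) volume r R :=
      intervalIntegral.intervalIntegrable_inv (fun y hy h => h0 (h ▸ hy)) continuousOn_id
    have h2 := (intervalIntegrable_iff_integrableOn_Ioc_of_le hR).1 this
    rw [← integrableOn_Icc_iff_integrableOn_Ioc] at h2
    exact h2.mono_set Ico_subset_Icc_self
  · rw [integral_fun_norm_addHaar volume f]
    simp only [finrank_euclideanSpace, Fintype.card_fin]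
    simp_rw [h1]
    rw [setIntegral_indicator measurableSet_Ico, hset, integral_Ico_eq_integral_Ioc,
      ← intervalIntegral.integral_of_le hR, integral_inv h0, measureReal_def,
      EuclideanSpace.volume_ball_fin_two]
    simp [ENNReal.toReal_ofReal Real.pi_pos.le]
    ring

/-- The contribution of far away vorticity, bounded by rearrangement. -/
lemma integral_far_le {W L r : ℝ} (hW : 0 ≤ W) (hL : 0 ≤ L) (hr : 0 < r) {f : Plane → ℝ}
    (hf : Integrable f) (hfW : ∀ z, |f z| ≤ W) (hfL : ∫ z, |f z| ≤ W * (Real.pi * L ^ 2)) :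
    ∫⁻ z, ENNReal.ofReal ((Metric.ball (0 : Plane) r)ᶜ.indicator
        (fun z => |f z| * (‖z‖ ^ 2)⁻¹) z) ≤
      ENNReal.ofReal (W * (2 * Real.pi * Real.log (1 + L / r) + Real.pi)) := by
  -- With this radius the annulus gives exactly `log (1 + L / r)`, while beyond `R` the integral
  -- bound gives at most `W π L² / R² ≤ W π`.
  set R := r + L with hR
  have hR0 : 0 < R := by positivity
  obtain ⟨hi, he⟩ := integral_annulus hr (show r ≤ R by linarith)
  have hle : ∀ z, (Metric.ball (0 : Plane) r)ᶜ.indicator (fun z => |f z| * (‖z‖ ^ 2)⁻¹) z ≤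
      W * (Ico r R).indicator (fun t => (t ^ 2)⁻¹) ‖z‖ + |f z| * (R ^ 2)⁻¹ := by
    intro z
    have h0 : 0 ≤ |f z| * (R ^ 2)⁻¹ := by positivity
    by_cases hz : z ∈ (Metric.ball (0 : Plane) r)ᶜ
    · rw [indicator_of_mem hz]
      have hzr : r ≤ ‖z‖ := by simpa using hz
      by_cases hzR : ‖z‖ < R
      · rw [indicator_of_mem (show ‖z‖ ∈ Ico r R from ⟨hzr, hzR⟩)]
        have : |f z| * (‖z‖ ^ 2)⁻¹ ≤ W * (‖z‖ ^ 2)⁻¹ := by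
          gcongr
          exact hfW z
        linarith
      · rw [indicator_of_notMem (fun h => hzR h.2), mul_zero, zero_add]
        gcongr
        exact not_lt.1 hzR
    · rw [indicator_of_notMem hz]
      have : 0 ≤ (Ico r R).indicator (fun t => (t ^ 2)⁻¹) ‖z‖ :=
        indicator_nonneg (fun _ _ => by positivity) _
      positivity
  have hint : Integrable fun z => W * (Ico r R).indicator (fun t => (t ^ 2)⁻¹) ‖z‖ +
      |f z| * (R ^ 2)⁻¹ := (hi.const_mul W).add (hf.abs.mul_const (R ^ 2)⁻¹)
  calc _ ≤ ∫⁻ z, ENNReal.ofReal (W * (Ico r R).indicator (fun t => (t ^ 2)⁻¹) ‖z‖ +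
          |f z| * (R ^ 2)⁻¹) := lintegral_mono fun z => ENNReal.ofReal_le_ofReal (hle z)
    _ = ENNReal.ofReal (∫ z, (W * (Ico r R).indicator (fun t => (t ^ 2)⁻¹) ‖z‖ +
          |f z| * (R ^ 2)⁻¹)) := by
        rw [ofReal_integral_eq_lintegral_ofReal hint]
        refine Eventually.of_forall fun z => ?_
        have : 0 ≤ (Ico r R).indicator (fun t => (t ^ 2)⁻¹) ‖z‖ :=
          indicator_nonneg (fun _ _ => by positivity) _
        simp only [Pi.zero_apply]
        positivity
    _ ≤ _ := by
        apply ENNReal.ofReal_le_ofReal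
        rw [integral_add (hi.const_mul W) (hf.abs.mul_const (R ^ 2)⁻¹), integral_const_mul,
          integral_mul_const, he, mul_add]
        have h1 : R / r = 1 + L / r := by rw [hR]; field_simp
        rw [h1]
        refine add_le_add le_rfl ?_
        calc (∫ z, |f z|) * (R ^ 2)⁻¹ ≤ W * (Real.pi * L ^ 2) * (R ^ 2)⁻¹ := by gcongr
          _ = W * Real.pi * (L ^ 2 / R ^ 2) := by ring
          _ ≤ W * Real.pi * 1 := by
            gcongr
            rw [div_le_one (by positivity)]
            gcongr
            linarith
          _ = _ := mul_one _

end Far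

/-! ### The mollified Heaviside function. -/

section Heaviside

lemma measurable_heaviside : Measurable heaviside :=
  Measurable.ite measurableSet_Ici measurable_const measurable_const

lemma heaviside_nonneg (s : ℝ) : 0 ≤ heaviside s := by
  unfold heaviside; split_ifs <;> norm_num

lemma heaviside_le_one (s : ℝ) : heaviside s ≤ 1 := by
  unfold heaviside; split_ifs <;> norm_num

variable {ρ : ℝ → ℝ} {n : ℕ}

lemma IsMollifier.eq_zero (hρ : IsMollifier ρ) {s : ℝ} (hs : s ∉ Icc (-1 : ℝ) 1) : ρ s = 0 :=
  image_eq_zero_of_notMem_tsupport fun h => hs (hρ.support h)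

lemma IsMollifier.integrable (hρ : IsMollifier ρ) : Integrable ρ :=
  hρ.smooth.continuous.integrable_of_hasCompactSupport
    (HasCompactSupport.of_support_subset_isCompact isCompact_Icc
      ((subset_tsupport ρ).trans hρ.support))

lemma IsMollifier.integrable_scaled (hρ : IsMollifier ρ) (hn : 1 ≤ n) :
    Integrable fun r => (n : ℝ) * ρ (n * r) :=
  (hρ.integrable.comp_mul_left' (by positivity)).const_mul _

lemma IsMollifier.integral_scaled (hρ : IsMollifier ρ) (hn : 1 ≤ n) :
    ∫ r, (n : ℝ) * ρ (n * r) = 1 := by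
  have hn0 : (0 : ℝ) < n := by exact_mod_cast hn
  rw [integral_const_mul, Measure.integral_comp_mul_left, hρ.integral, abs_of_pos (by positivity)]
  simp [hn0.ne']

lemma IsMollifier.integrable_mul_heaviside (hρ : IsMollifier ρ) (hn : 1 ≤ n) (s : ℝ) :
    Integrable fun r => ((n : ℝ) * ρ (n * r)) * heaviside (s - r) := by
  refine (hρ.integrable_scaled hn).mono' ?_ (Eventually.of_forall fun r => ?_)
  · exact (hρ.integrable_scaled hn).aestronglyMeasurable.mul
      (measurable_heaviside.comp (by fun_prop)).aestronglyMeasurable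
  · have h0 := hρ.nonneg (n * r)
    rw [Real.norm_of_nonneg (mul_nonneg (by positivity) (heaviside_nonneg _))]
    exact mul_le_of_le_one_right (by positivity) (heaviside_le_one _)

lemma IsMollifier.smoothHeaviside_nonneg (hρ : IsMollifier ρ) (s : ℝ) :
    0 ≤ smoothHeaviside ρ n s :=
  integral_nonneg fun r => mul_nonneg (mul_nonneg (by positivity) (hρ.nonneg _))
    (heaviside_nonneg _)

lemma IsMollifier.smoothHeaviside_le_one (hρ : IsMollifier ρ) (hn : 1 ≤ n) (s : ℝ) :
    smoothHeaviside ρ n s ≤ 1 := by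
  rw [← hρ.integral_scaled hn, smoothHeaviside]
  refine integral_mono (hρ.integrable_mul_heaviside hn _) (hρ.integrable_scaled hn) fun r => ?_
  exact mul_le_of_le_one_right (mul_nonneg (by positivity) (hρ.nonneg _)) (heaviside_le_one _)

/-- Because of the shift by `1/n`, the mollifier lives on `r ≥ -1/n` and the Heaviside factor on `r
≤ s - 1/n ≤ -1/n`. They meet in at most one point, a null set. -/
lemma IsMollifier.smoothHeaviside_eq_zero (hρ : IsMollifier ρ) (hn : 1 ≤ n) {s : ℝ} (hs : s ≤ 0) :
    smoothHeaviside ρ n s = 0 := by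
  have hn0 : (0 : ℝ) < n := by exact_mod_cast hn
  rw [smoothHeaviside]
  have : (fun r => ((n : ℝ) * ρ (n * r)) * heaviside ((s - 1 / n) - r)) =ᵐ[volume] 0 := by
    have hne : ∀ᵐ r : ℝ, r ≠ -(1 / (n : ℝ)) := by
      simp [ae_iff]
    filter_upwards [hne] with r hr
    simp only [Pi.zero_apply, mul_eq_zero]
    by_cases h : r < -(1 / (n : ℝ))
    · left; right
      apply hρ.eq_zero
      intro hmem
      have : (n : ℝ) * r < -1 := by
        have := mul_lt_mul_of_pos_left h hn0
        field_simp at this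
        linarith
      linarith [hmem.1]
    · right
      have h' : -(1 / (n : ℝ)) < r := lt_of_le_of_ne (not_lt.1 h) (Ne.symm hr)
      rw [heaviside, if_neg]
      rw [not_le]
      linarith
  rw [integral_congr_ae this]
  simp

end Heaviside

/-! ### The logarithmic bound at a fixed time. -/

section GradientBound

variable {ρ : ℝ → ℝ} {n : ℕ} {μ m H r L ω₀ c : ℝ} {φ w : Plane → ℝ} {g : Plane → Plane}

/-- The contribution of nearby vorticity, decomposed into its superlevel sets. -/
lemma norm_integral_near_le (hμ₀ : 0 < μ) (hμ₁ : μ < 1) (hρ : IsMollifier ρ) (hn : 1 ≤ n)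
    (hφ : Differentiable ℝ φ) (hm : 0 < m) (hH : 0 < H) (hr : 0 < r)
    (hrD : r ^ μ = m / H / 16)
    (hlow : ∀ x, φ x ∈ Icc (0 : ℝ) (2 / n) → m ≤ ‖fderiv ℝ φ x‖)
    (hhol : ∀ x y, ‖fderiv ℝ φ x - fderiv ℝ φ y‖ ≤ H * ‖x - y‖ ^ μ)
    (hg : IsStressKernel c g) (x : Plane) :
    ‖∫ z in Metric.ball 0 r, smoothHeaviside ρ n (φ (x - z)) • g z‖ ≤
      c * (8 * Real.pi + 8 / μ) := by
  have hn0 : (0 : ℝ) < n := by exact_mod_cast hn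
  have hc := hg.nonneg
  have hφc := hφ.continuous
  set ρn : ℝ → ℝ := fun t => (n : ℝ) * ρ (n * t) with hρn
  have hρn0 : ∀ t, 0 ≤ ρn t := fun t => mul_nonneg hn0.le (hρ.nonneg _)
  have hρni : Integrable ρn := hρ.integrable_scaled hn
  have hgi : IntegrableOn g (Metric.ball 0 r) volume := hg.integrableOn r subset_rfl
  -- After exchanging the integrals, each `t` carries the indicator of `{φ (x - ·) ≥ t + 1/n}`, with
  -- weights `ρn t` of total mass one.
  set J : Plane → ℝ → Plane := fun z t => (ρn t * heaviside ((φ (x - z) - 1 / n) - t)) • g z with hJ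
  have h1 : ∀ z, smoothHeaviside ρ n (φ (x - z)) • g z = ∫ t, J z t := by
    intro z
    rw [hJ, integral_smul_const, smoothHeaviside]
  have hJi : Integrable (Function.uncurry J)
      ((volume.restrict (Metric.ball (0 : Plane) r)).prod volume) := by
    have hdom : Integrable (fun p : Plane × ℝ => ρn p.2 • g p.1)
        ((volume.restrict (Metric.ball (0 : Plane) r)).prod volume) := by
      have := hρni.smul_prod hgi
      exact this.swap
    refine hdom.mono ?_ (Eventually.of_forall fun p => ?_)
    · have hh : Measurable fun p : Plane × ℝ => heaviside ((φ (x - p.1) - 1 / n) - p.2) :=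
        measurable_heaviside.comp (by
          have : Continuous fun p : Plane × ℝ => (φ (x - p.1) - 1 / n) - p.2 := by fun_prop
          exact this.measurable)
      have := hh.aestronglyMeasurable.smul hdom.aestronglyMeasurable
      refine this.congr (Eventually.of_forall fun p => ?_)
      simp only [Function.uncurry, hJ, smul_smul, Pi.smul_apply']
      rw [mul_comm]
    · simp only [Function.uncurry, hJ]
      rw [norm_smul, norm_smul, Real.norm_of_nonneg (mul_nonneg (hρn0 _) (heaviside_nonneg _)),
        Real.norm_of_nonneg (hρn0 _)]
      gcongr
      exact mul_le_of_le_one_right (hρn0 _) (heaviside_le_one _)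
  simp_rw [h1]
  rw [integral_integral_swap hJi]
  have hinner : ∀ t, ‖∫ z in Metric.ball 0 r, J z t‖ ≤ ρn t * (c * (8 * Real.pi + 8 / μ)) := by
    intro t
    have h2 : ∀ z, J z t = ρn t • {z | t + 1 / n ≤ φ (x - z)}.indicator g z := by
      intro z
      simp only [hJ, heaviside, mul_smul]
      congr 1
      by_cases hz : t + 1 / n ≤ φ (x - z)
      · rw [if_pos (by linarith), one_smul, indicator_of_mem (by exact hz)]
      · rw [if_neg (by linarith), zero_smul, indicator_of_notMem (by exact hz)]
    simp_rw [h2]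
    rw [integral_smul, norm_smul, Real.norm_of_nonneg (hρn0 t)]
    -- On the support of `ρn` the level `t + 1/n` lies in `[0, 2/n]`, exactly where the gradient is
    -- bounded below.
    by_cases ht : (n : ℝ) * t ∈ Icc (-1 : ℝ) 1
    · refine mul_le_mul_of_nonneg_left ?_ (hρn0 t)
      have hfd : ∀ z, HasFDerivAt (fun z => φ (x - z)) (-fderiv ℝ φ (x - z)) z := by
        intro z
        have := (hφ (x - z)).hasFDerivAt.comp z ((hasFDerivAt_id z).const_sub x)
        simpa [Function.comp_def] using this
      refine hg.norm_setIntegral_superlevel_le hμ₀ hμ₁ hm hH hr hrD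
        (fun z => (hfd z).differentiableAt) (fun z hz => ?_) (fun y z => ?_)
      · rw [(hfd z).fderiv, norm_neg]
        apply hlow
        rw [hz]
        have e1 : t + 1 / n = (n * t + 1) / n := by field_simp
        rw [e1]
        constructor
        · exact div_nonneg (by linarith [ht.1]) hn0.le
        · gcongr
          linarith [ht.2]
      · rw [(hfd y).fderiv, (hfd z).fderiv]
        have := hhol (x - z) (x - y)
        rw [show x - z - (x - y) = y - z by abel] at this
        rwa [neg_sub_neg]
    · have : ρn t = 0 := by
        simp only [hρn]
        rw [hρ.eq_zero ht, mul_zero]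
      rw [this, zero_mul, zero_mul]
  calc _ ≤ ∫ t, ρn t * (c * (8 * Real.pi + 8 / μ)) :=
        norm_integral_le_of_norm_le (hρni.mul_const _) (Eventually.of_forall hinner)
    _ = c * (8 * Real.pi + 8 / μ) := by
        rw [integral_mul_const, hρ.integral_scaled hn, one_mul]

/-- The integral of the vorticity against a stress kernel. -/
lemma norm_integral_stress_le (hμ₀ : 0 < μ) (hμ₁ : μ < 1) (hρ : IsMollifier ρ) (hn : 1 ≤ n)
    (hφ : Differentiable ℝ φ) (hm : 0 < m) (hH : 0 < H) (hr : 0 < r)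
    (hrD : r ^ μ = m / H / 16) (hL : 0 ≤ L)
    (hlow : ∀ x, φ x ∈ Icc (0 : ℝ) (2 / n) → m ≤ ‖fderiv ℝ φ x‖)
    (hhol : ∀ x y, ‖fderiv ℝ φ x - fderiv ℝ φ y‖ ≤ H * ‖x - y‖ ^ μ)
    (hwc : Continuous w) (hcs : HasCompactSupport w)
    (hw : ∀ x, w x = ω₀ * smoothHeaviside ρ n (φ x))
    (hwL : ∫ x, |w x| ≤ |ω₀| * (Real.pi * L ^ 2))
    (hg : IsStressKernel c g) (x : Plane) :
    ‖∫ z, w (x - z) • g z‖ ≤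
      c * |ω₀| * (9 * Real.pi + 8 / μ + 2 * Real.pi * Real.log (1 + L / r)) := by
  have hc := hg.nonneg
  have hwx : Continuous fun z => w (x - z) := hwc.comp (continuous_const.sub continuous_id)
  have hcw : HasCompactSupport fun z => w (x - z) := hcs.comp_homeomorph (Homeomorph.subLeft x)
  have hint : Integrable fun z => w (x - z) • g z :=
    (hwx.smul hg.continuous).integrable_of_hasCompactSupport hcw.smul_right
  have hwi : Integrable fun z => w (x - z) := hwx.integrable_of_hasCompactSupport hcw
  rw [← integral_add_compl (measurableSet_ball (x := (0 : Plane)) (ε := r)) hint]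
  have hnear : ‖∫ z in Metric.ball 0 r, w (x - z) • g z‖ ≤
      |ω₀| * (c * (8 * Real.pi + 8 / μ)) := by
    have : ∀ z, w (x - z) • g z = ω₀ • (smoothHeaviside ρ n (φ (x - z)) • g z) := by
      intro z; rw [hw, mul_smul]
    simp_rw [this]
    rw [integral_smul, norm_smul, Real.norm_eq_abs]
    gcongr
    exact norm_integral_near_le hμ₀ hμ₁ hρ hn hφ hm hH hr hrD hlow hhol hg x
  have hlog : 0 ≤ Real.log (1 + L / r) := Real.log_nonneg (by
    have : 0 ≤ L / r := by positivity
    linarith)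
  have hfar : ‖∫ z in (Metric.ball 0 r)ᶜ, w (x - z) • g z‖ ≤
      c * (|ω₀| * (2 * Real.pi * Real.log (1 + L / r) + Real.pi)) := by
    refine (norm_integral_le_lintegral_norm _).trans ?_
    refine ENNReal.toReal_le_of_le_ofReal (by positivity) ?_
    rw [ENNReal.ofReal_mul hc]
    have hW : ∀ z, |w (x - z)| ≤ |ω₀| := by
      intro z
      rw [hw, abs_mul, abs_of_nonneg (hρ.smoothHeaviside_nonneg _)]
      exact mul_le_of_le_one_right (abs_nonneg _) (hρ.smoothHeaviside_le_one hn _)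
    have hwL' : ∫ z, |w (x - z)| ≤ |ω₀| * (Real.pi * L ^ 2) := by
      rwa [integral_sub_left_eq_self (fun y => |w y|) volume x]
    refine le_trans ?_ (mul_le_mul_right
      (integral_far_le (abs_nonneg ω₀) hL hr hwi hW hwL') (ENNReal.ofReal c))
    rw [← lintegral_const_mul' _ _ ENNReal.ofReal_ne_top,
      ← lintegral_indicator measurableSet_ball.compl]
    refine lintegral_mono fun z => ?_
    by_cases hz : z ∈ (Metric.ball (0 : Plane) r)ᶜ
    · simp only [indicator_of_mem hz]
      rw [← ENNReal.ofReal_mul hc]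
      apply ENNReal.ofReal_le_ofReal
      rw [norm_smul, Real.norm_eq_abs]
      calc |w (x - z)| * ‖g z‖ ≤ |w (x - z)| * (c * (‖z‖ ^ 2)⁻¹) := by
            gcongr; exact hg.norm_le z
        _ = _ := by ring
    · simp only [indicator_of_notMem hz]
      exact zero_le
  refine (norm_add_le _ _).trans ((add_le_add hnear hfar).trans (le_of_eq ?_))
  ring

/-- The logarithmic bound for the velocity gradient of a mollified vortex patch. -/
theorem norm_fderiv_biotSavart_le (hμ₀ : 0 < μ) (hμ₁ : μ < 1) (hρ : IsMollifier ρ) (hn : 1 ≤ n)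
    (hφ : Differentiable ℝ φ) (hm : 0 < m) (hH : 0 < H) (hL : 0 ≤ L)
    (hlow : ∀ x, φ x ∈ Icc (0 : ℝ) (2 / n) → m ≤ ‖fderiv ℝ φ x‖)
    (hhol : ∀ x y, ‖fderiv ℝ φ x - fderiv ℝ φ y‖ ≤ H * ‖x - y‖ ^ μ)
    (hwd : ContDiff ℝ 1 w) (hcs : HasCompactSupport w)
    (hw : ∀ x, w x = ω₀ * smoothHeaviside ρ n (φ x))
    (hwL : ∫ x, |w x| ≤ |ω₀| * (Real.pi * L ^ 2)) (x : Plane) :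
    ‖fderiv ℝ (biotSavart w) x‖ ≤ (5 + 8 / μ + Real.log 16 / μ) * |ω₀| *
      (1 + Real.log (1 + L / (m / H) ^ (1 / μ))) := by
  set δ := (m / H) ^ (1 / μ) with hδ
  have hmH : 0 < m / H := div_pos hm hH
  have hδ0 : 0 < δ := Real.rpow_pos_of_pos hmH _
  -- Chosen so that `r = δ / K` satisfies `r ^ μ = m / H / 16`. Replacing `r` by `δ` in the
  -- logarithm costs `log K = log 16 / μ`.
  set K : ℝ := 16 ^ (1 / μ) with hK
  have hK1 : 1 ≤ K := Real.one_le_rpow (by norm_num) (by positivity)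
  have hK0 : 0 < K := by linarith
  set r := δ / K with hr
  have hr0 : 0 < r := div_pos hδ0 hK0
  have hrD : r ^ μ = m / H / 16 := by
    rw [hr, Real.div_rpow hδ0.le hK0.le, hδ, hK, ← Real.rpow_mul hmH.le,
      ← Real.rpow_mul (by norm_num), one_div_mul_cancel hμ₀.ne', Real.rpow_one, Real.rpow_one]
  have hLδ : 0 ≤ L / δ := by positivity
  have hlog0 : 0 ≤ Real.log (1 + L / δ) := Real.log_nonneg (by linarith)
  have hlog : Real.log (1 + L / r) ≤ Real.log 16 / μ + Real.log (1 + L / δ) := by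
    have h1 : 1 + L / r ≤ K * (1 + L / δ) := by
      have : L / r = K * (L / δ) := by rw [hr]; field_simp
      rw [this]
      linarith
    calc Real.log (1 + L / r) ≤ Real.log (K * (1 + L / δ)) :=
          Real.log_le_log (by positivity) h1
      _ = _ := by
          rw [Real.log_mul hK0.ne' (by positivity), hK, Real.log_rpow (by norm_num)]
          ring
  have hl16 : 0 ≤ Real.log 16 := Real.log_nonneg (by norm_num)
  refine ContinuousLinearMap.opNorm_le_bound _ (by positivity) fun e => ?_
  have hε0 : ∀ k : ℕ, 0 < 1 / ((k : ℝ) + 1) := fun k => by positivity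
  refine le_of_tendsto (tendsto_integral_smoothKernelDeriv hwd hcs x e hε0
    tendsto_one_div_add_atTop_nhds_zero_nat).norm (Eventually.of_forall fun k => ?_)
  set ε : ℝ := 1 / ((k : ℝ) + 1) with hε
  have hεp : 0 < ε := hε0 k
  have hwx : Continuous fun z => w (x - z) :=
    hwd.continuous.comp (continuous_const.sub continuous_id)
  have hcw : HasCompactSupport fun z => w (x - z) := hcs.comp_homeomorph (Homeomorph.subLeft x)
  set g : Plane → Plane := fun z => ((‖z‖ ^ 2 + ε ^ 2) ^ 2)⁻¹ • scaledReflection z e with hgdef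
  have hg : IsStressKernel ‖e‖ g := isStressKernel_scaledReflection hεp e
  set b : Plane → ℝ := fun z => ε ^ 2 / (‖z‖ ^ 2 + ε ^ 2) ^ 2 with hb
  have hbc : Continuous b := by
    have hq : ∀ z : Plane, (‖z‖ ^ 2 + ε ^ 2) ^ 2 ≠ 0 := fun z => by positivity
    fun_prop (disch := exact hq _)
  obtain ⟨hbi, hbπ⟩ := integral_bump hεp
  have hi1 : Integrable fun z => w (x - z) • b z • e :=
    (hwx.smul (hbc.smul continuous_const)).integrable_of_hasCompactSupport hcw.smul_right
  have hi2 : Integrable fun z => w (x - z) • g z :=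
    (hwx.smul hg.continuous).integrable_of_hasCompactSupport hcw.smul_right
  have hsplit : ∫ z, w (x - z) • smoothKernelDeriv ε z e = (1 / (2 * Real.pi)) •
      rot ((∫ z, w (x - z) • b z • e) - ∫ z, w (x - z) • g z) := by
    have hrot : rot (∫ z, (w (x - z) • b z • e - w (x - z) • g z)) =
        ∫ z, rot (w (x - z) • b z • e - w (x - z) • g z) :=
      (rot.toContinuousLinearEquiv.integral_comp_comm _).symm
    rw [← integral_sub hi1 hi2, hrot, ← integral_smul]
    congr 1
    ext1 z
    change w (x - z) • ((1 / (2 * Real.pi)) • rot (b z • e - g z)) =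
      (1 / (2 * Real.pi)) • rot (w (x - z) • b z • e - w (x - z) • g z)
    rw [← smul_sub, map_smul, smul_comm]
  rw [hsplit, norm_smul, LinearIsometryEquiv.norm_map, Real.norm_of_nonneg (by positivity)]
  have hbound1 : ‖∫ z, w (x - z) • b z • e‖ ≤ |ω₀| * ‖e‖ * Real.pi := by
    rw [← hbπ, ← integral_const_mul]
    refine norm_integral_le_of_norm_le (hbi.const_mul _) (Eventually.of_forall fun z => ?_)
    rw [norm_smul, norm_smul, hw, Real.norm_eq_abs, abs_mul,
      abs_of_nonneg (hρ.smoothHeaviside_nonneg _), Real.norm_of_nonneg (by positivity)]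
    have := hρ.smoothHeaviside_le_one hn (φ (x - z))
    calc |ω₀| * smoothHeaviside ρ n (φ (x - z)) * (b z * ‖e‖) ≤ |ω₀| * 1 * (b z * ‖e‖) := by
          have : 0 ≤ b z := by positivity
          gcongr
      _ = _ := by ring
  have hbound2 := norm_integral_stress_le hμ₀ hμ₁ hρ hn hφ hm hH hr0 hrD hL hlow hhol
    hwd.continuous hcs hw hwL hg x
  have hπ := Real.pi_gt_three
  set ℓ := Real.log (1 + L / δ) with hℓ
  calc 1 / (2 * Real.pi) * ‖(∫ z, w (x - z) • b z • e) - ∫ z, w (x - z) • g z‖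
      ≤ 1 / (2 * Real.pi) * (|ω₀| * ‖e‖ * Real.pi +
        ‖e‖ * |ω₀| * (9 * Real.pi + 8 / μ + 2 * Real.pi * (Real.log 16 / μ + ℓ))) := by
        gcongr
        refine (norm_sub_le _ _).trans (add_le_add hbound1 (hbound2.trans ?_))
        gcongr
    _ = |ω₀| * ‖e‖ * (5 + 8 / μ * (1 / (2 * Real.pi)) + Real.log 16 / μ + ℓ) := by
        field_simp
        ring
    _ ≤ |ω₀| * ‖e‖ * ((5 + 8 / μ + Real.log 16 / μ) * (1 + ℓ)) := by
        gcongr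
        have h1 : 8 / μ * (1 / (2 * Real.pi)) ≤ 8 / μ :=
          mul_le_of_le_one_right (by positivity) inv_two_pi_le_one
        have h2 : 0 ≤ 8 / μ * ℓ := by positivity
        have h3 : 0 ≤ Real.log 16 / μ * ℓ := by positivity
        nlinarith
    _ = _ := by ring

end GradientBound

/-! ### Conservation laws and regularity of the vorticity solution. -/

section Solution

lemma norm_gradient_eq (f : Plane → ℝ) (x : Plane) : ‖∇ f x‖ = ‖fderiv ℝ f x‖ := by
  rw [gradient, LinearIsometryEquiv.norm_map]

lemma norm_gradient_sub_eq (f : Plane → ℝ) (x y : Plane) :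
    ‖∇ f x - ∇ f y‖ = ‖fderiv ℝ f x - fderiv ℝ f y‖ := by
  rw [gradient, gradient, ← map_sub, LinearIsometryEquiv.norm_map]

lemma continuous_of_norm_sub_le {E F : Type*} [NormedAddCommGroup E] [NormedAddCommGroup F]
    {f : E → F} {C μ : ℝ} (hμ : 0 < μ) (h : ∀ x y, ‖f x - f y‖ ≤ C * ‖x - y‖ ^ μ) :
    Continuous f := by
  rw [continuous_iff_continuousAt]
  intro x
  rw [ContinuousAt, tendsto_iff_norm_sub_tendsto_zero]
  have h1 : Tendsto (fun y => ‖y - x‖) (𝓝 x) (𝓝 0) := by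
    simpa using (tendsto_iff_norm_sub_tendsto_zero (f := fun y : E => y) (b := x)).1 tendsto_id
  have h2 : Tendsto (fun y => C * ‖y - x‖ ^ μ) (𝓝 x) (𝓝 0) := by
    have := (h1.rpow_const (p := μ) (Or.inr hμ.le)).const_mul C
    rwa [Real.zero_rpow hμ.ne', mul_zero] at this
  exact squeeze_zero (fun _ => norm_nonneg _) (fun y => h y x) h2

/-- The flux of a compactly supported vorticity through its own velocity field vanishes. -/
lemma integral_inner_biotSavart_gradient {w : Plane → ℝ} (hw : ContDiff ℝ 1 w)
    (hc : HasCompactSupport w) : ∫ x, inner ℝ (biotSavart w x) (∇ w x) = 0 := by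
  have hd := differentiable_biotSavart hw hc
  set e : Fin 2 → Plane := fun i => EuclideanSpace.single i 1 with he
  have hcd : ∀ i, Continuous fun x => fderiv ℝ w x (e i) := fun i =>
    (hw.continuous_fderiv one_ne_zero).clm_apply continuous_const
  -- The derivative is the velocity generated by `∂ᵢ w`, hence Hölder continuous; the exponent `1/2`
  -- is arbitrary.
  have hcv : ∀ i, Continuous fun x => fderiv ℝ (biotSavart w) x (e i) := by
    intro i
    obtain ⟨R, hR⟩ := (hc.fderiv_apply (𝕜 := ℝ) (e i)).isBounded.subset_closedBall 0
    obtain ⟨C, _, hC⟩ := exists_norm_biotSavart_le (μ := 1 / 2) (by norm_num) (by norm_num) R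
    obtain ⟨G, hG⟩ := (hcd i).bounded_above_of_compact_support (hc.fderiv_apply (𝕜 := ℝ) (e i))
    simp_rw [fderiv_biotSavart_apply hw hc]
    refine continuous_of_norm_sub_le (by norm_num) (hC _ G (hcd i) hG fun x hx => ?_).2
    refine image_eq_zero_of_notMem_tsupport (f := fun x => fderiv ℝ w x (e i)) fun h => ?_
    have := hR h
    simp at this
    linarith
  have hfi : ∀ i : Fin 2, ∀ x, HasFDerivAt (fun x => biotSavart w x i)
      ((EuclideanSpace.proj i : Plane →L[ℝ] ℝ).comp (fderiv ℝ (biotSavart w) x)) x := fun i x =>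
    (EuclideanSpace.proj i : Plane →L[ℝ] ℝ).hasFDerivAt.comp x (hd x).hasFDerivAt
  have hfe : ∀ i : Fin 2, ∀ x, fderiv ℝ (fun x => biotSavart w x i) x (e i) =
      fderiv ℝ (biotSavart w) x (e i) i := by
    intro i x
    rw [(hfi i x).fderiv]
    rfl
  have hvc : ∀ i : Fin 2, Continuous fun x => biotSavart w x i := fun i =>
    continuous_iff_continuousAt.2 fun x => (hfi i x).continuousAt
  have hcvi : ∀ i : Fin 2, Continuous fun x => fderiv ℝ (biotSavart w) x (e i) i := fun i =>
    (EuclideanSpace.proj i : Plane →L[ℝ] ℝ).continuous.comp (hcv i)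
  have hint1 : ∀ i : Fin 2, Integrable fun x => biotSavart w x i * fderiv ℝ w x (e i) := fun i =>
    ((hvc i).mul (hcd i)).integrable_of_hasCompactSupport (hc.fderiv_apply (𝕜 := ℝ) (e i)).mul_left
  have hint2 : ∀ i : Fin 2, Integrable fun x => fderiv ℝ (biotSavart w) x (e i) i * w x := fun i =>
    ((hcvi i).mul hw.continuous).integrable_of_hasCompactSupport hc.mul_left
  have hibp : ∀ i : Fin 2, ∫ x, biotSavart w x i * fderiv ℝ w x (e i) =
      -∫ x, fderiv ℝ (biotSavart w) x (e i) i * w x := by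
    intro i
    have := integral_mul_fderiv_eq_neg_fderiv_mul_of_integrable (μ := volume)
      (f := fun x => biotSavart w x i) (g := w) (v := e i) (by simpa only [hfe] using hint2 i)
      (hint1 i) (((hvc i).mul hw.continuous).integrable_of_hasCompactSupport hc.mul_left)
      (fun x _ => (hfi i x).differentiableAt)
      (fun x _ => (hw.differentiable one_ne_zero) x)
    simpa only [hfe] using this
  have hexp : ∀ x, inner ℝ (biotSavart w x) (∇ w x) =
      biotSavart w x 0 * fderiv ℝ w x (e 0) + biotSavart w x 1 * fderiv ℝ w x (e 1) := by
    intro x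
    have hv : biotSavart w x = biotSavart w x 0 • e 0 + biotSavart w x 1 • e 1 := by
      ext i; fin_cases i <;> simp [he]
    rw [real_inner_comm, gradient, InnerProductSpace.toDual_symm_apply]
    conv_lhs => rw [hv]
    rw [map_add, map_smul, map_smul, smul_eq_mul, smul_eq_mul]
  simp_rw [hexp]
  rw [integral_add (hint1 0) (hint1 1), hibp, hibp, ← neg_add, ← integral_add (hint2 0) (hint2 1),
    neg_eq_zero]
  refine integral_eq_zero_of_ae (Eventually.of_forall fun x => ?_)
  have := sum_inner_fderiv_biotSavart hw hc x
  rw [Fin.sum_univ_two] at this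
  simp only [Pi.zero_apply]
  rw [← add_mul, this, zero_mul]

namespace IsVorticitySolution

variable {w₀ : Plane → ℝ} {ω : ℝ → Plane → ℝ} {v : ℝ → Plane → Plane}

lemma eq_biotSavart (h : IsVorticitySolution w₀ ω v) (t : ℝ) : v t = VortexPatch.biotSavart (ω t) :=
  funext fun x => h.biotSavart t x

lemma contDiff_apply (h : IsVorticitySolution w₀ ω v) (t : ℝ) : ContDiff ℝ 1 (ω t) :=
  h.contDiff.comp (contDiff_const.prodMk contDiff_id)

lemma hasCompactSupport (h : IsVorticitySolution w₀ ω v) (t : ℝ) : HasCompactSupport (ω t) := by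
  obtain ⟨R, hR⟩ := h.compactSupport |t|
  exact HasCompactSupport.intro (isCompact_closedBall 0 R)
    fun x hx => hR t x le_rfl (by simpa using hx)

lemma hasFDerivAt (h : IsVorticitySolution w₀ ω v) (p : ℝ × Plane) :
    HasFDerivAt (fun p : ℝ × Plane => ω p.1 p.2)
      (fderiv ℝ (fun p : ℝ × Plane => ω p.1 p.2) p) p :=
  (h.contDiff.differentiable one_ne_zero p).hasFDerivAt

lemma hasDerivAt_time (h : IsVorticitySolution w₀ ω v) (t : ℝ) (x : Plane) :
    HasDerivAt (fun s => ω s x) (fderiv ℝ (fun p : ℝ × Plane => ω p.1 p.2) (t, x) (1, 0)) t :=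
  (h.hasFDerivAt (t, x)).comp_hasDerivAt (f := fun s => (s, x)) t ((hasDerivAt_id t).prodMk (hasDerivAt_const t x))

lemma fderiv_space (h : IsVorticitySolution w₀ ω v) (t : ℝ) (x : Plane) :
    fderiv ℝ (ω t) x = (fderiv ℝ (fun p : ℝ × Plane => ω p.1 p.2) (t, x)).comp
      (ContinuousLinearMap.inr ℝ ℝ Plane) :=
  ((h.hasFDerivAt (t, x)).comp x (hasFDerivAt_prodMk_right t x)).fderiv

/-- The space-time derivative of the vorticity is bounded on bounded time intervals. -/
lemma exists_norm_fderiv_le (h : IsVorticitySolution w₀ ω v) (T R : ℝ) :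
    ∃ G, 0 ≤ G ∧ ∀ t x, |t| ≤ T → ‖x‖ ≤ R →
      ‖fderiv ℝ (fun p : ℝ × Plane => ω p.1 p.2) (t, x)‖ ≤ G := by
  have hK : IsCompact (Icc (-T) T ×ˢ Metric.closedBall (0 : Plane) R) :=
    isCompact_Icc.prod (isCompact_closedBall 0 R)
  obtain ⟨G, hG⟩ := hK.exists_bound_of_continuousOn
    (h.contDiff.continuous_fderiv one_ne_zero).continuousOn
  refine ⟨max G 0, le_max_right _ _, fun t x ht hx => (hG (t, x) ⟨abs_le.1 ht, ?_⟩).trans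
    (le_max_left _ _)⟩
  simpa using hx

/-- On `[-T, T]` the vorticity has bounded gradient and support in one disc, so the kernel estimates
apply uniformly in time. The constants depend on the solution; they serve only the qualitative
regularity of the flow. -/
lemma isRegularField (h : IsVorticitySolution w₀ ω v) {μ : ℝ} (hμ₀ : 0 < μ) (hμ₁ : μ < 1)
    {T : ℝ} (hT : 0 ≤ T) : ∃ B H, IsRegularField v T B H μ := by
  obtain ⟨R, hR⟩ := h.compactSupport T
  obtain ⟨G, hG0, hG⟩ := h.exists_norm_fderiv_le T R
  obtain ⟨C, hC0, hC⟩ := exists_norm_fderiv_biotSavart_le hμ₀ hμ₁ R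
  have hGx : ∀ t, |t| ≤ T → ∀ x, ‖fderiv ℝ (ω t) x‖ ≤ G := by
    intro t ht x
    by_cases hx : ‖x‖ ≤ R
    · rw [h.fderiv_space]
      refine (ContinuousLinearMap.opNorm_comp_le _ _).trans ?_
      calc _ ≤ G * 1 := by
            gcongr
            · exact hG t x ht hx
            · exact ContinuousLinearMap.norm_inr_le_one ℝ ℝ Plane
        _ = G := mul_one G
    · have : ω t =ᶠ[𝓝 x] fun _ => 0 := by
        filter_upwards [continuous_norm.continuousAt.eventually (lt_mem_nhds (not_le.1 hx))]
          with y hy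
        exact hR t y ht hy
      rw [this.fderiv_eq]
      simpa using hG0
  have key := fun t (ht : |t| ≤ T) => hC (ω t) G (h.contDiff_apply t) (hGx t ht)
    (fun x hx => hR t x ht hx)
  refine ⟨C * G, C * G, hT, by positivity, by positivity, fun t _ => ?_, fun t ht => ?_,
    fun t ht => ?_⟩
  · rw [h.eq_biotSavart]
    exact differentiable_biotSavart (h.contDiff_apply t) (h.hasCompactSupport t)
  · rw [h.eq_biotSavart]
    exact (key t ht).1
  · rw [h.eq_biotSavart]
    exact (key t ht).2

/-- The vorticity is constant along trajectories. -/
lemma apply_trajectory (h : IsVorticitySolution w₀ ω v) {X : ℝ → Plane → Plane}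
    (hX : IsParticleTrajectory v X) (t : ℝ) (α : Plane) : ω t (X t α) = w₀ α := by
  have hd : ∀ s, HasDerivAt (fun s => ω s (X s α)) 0 s := by
    intro s
    have h1 := (h.hasFDerivAt (s, X s α)).comp_hasDerivAt s
      ((hasDerivAt_id s).prodMk (hX.hasDerivAt α s))
    refine h1.congr_deriv ?_
    have h2 := h.transport s (X s α)
    rw [(h.hasDerivAt_time s (X s α)).deriv, real_inner_comm, gradient,
      InnerProductSpace.toDual_symm_apply, h.fderiv_space] at h2
    rw [← h2, ContinuousLinearMap.comp_apply, ContinuousLinearMap.inr_apply, ← map_add]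
    simp
  have := is_const_of_deriv_eq_zero (fun s => (hd s).differentiableAt) (fun s => (hd s).deriv) t 0
  rw [this, hX.initial, h.initial]

/-- The total vorticity is conserved. -/
lemma integral_eq (h : IsVorticitySolution w₀ ω v) (t : ℝ) : ∫ x, ω t x = ∫ x, w₀ x := by
  -- Differentiation under the integral gives `-∫ v · ∇ω`, which vanishes because `v` is divergence
  -- free.
  have hd : ∀ s, HasDerivAt (fun s => ∫ x, ω s x) 0 s := by
    intro s
    obtain ⟨R, hR⟩ := h.compactSupport (|s| + 1)
    obtain ⟨G, hG0, hG⟩ := h.exists_norm_fderiv_le (|s| + 1) R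
    have hball : ∀ r ∈ Metric.ball s 1, |r| ≤ |s| + 1 := by
      intro r hr
      rw [Metric.mem_ball, Real.dist_eq] at hr
      have := abs_sub_abs_le_abs_sub r s
      linarith
    have hbound : ∀ x, ∀ r ∈ Metric.ball s 1,
        ‖fderiv ℝ (fun p : ℝ × Plane => ω p.1 p.2) (r, x) (1, 0)‖ ≤
          (Metric.closedBall (0 : Plane) R).indicator (fun _ => G) x := by
      intro x r hr
      by_cases hx : x ∈ Metric.closedBall (0 : Plane) R
      · rw [indicator_of_mem hx]
        refine ((fderiv ℝ _ (r, x)).le_opNorm _).trans ?_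
        have := hG r x (hball r hr) (by simpa using hx)
        simpa [Prod.norm_def] using this
      · rw [indicator_of_notMem hx, ← (h.hasDerivAt_time r x).deriv]
        have : (fun s => ω s x) =ᶠ[𝓝 r] fun _ => 0 := by
          filter_upwards [Metric.isOpen_ball.mem_nhds hr] with q hq
          exact hR q x (hball q hq) (by simpa using hx)
        rw [this.deriv_eq]
        simp
    have hcont : Continuous fun x => fderiv ℝ (fun p : ℝ × Plane => ω p.1 p.2) (s, x) (1, 0) :=
      ((h.contDiff.continuous_fderiv one_ne_zero).comp (by fun_prop)).clm_apply continuous_const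
    have := (hasDerivAt_integral_of_dominated_loc_of_deriv_le (μ := volume)
      (F := fun s x => ω s x)
      (F' := fun r x => fderiv ℝ (fun p : ℝ × Plane => ω p.1 p.2) (r, x) (1, 0))
      (bound := (Metric.closedBall (0 : Plane) R).indicator (fun _ => G))
      (Metric.ball_mem_nhds s one_pos)
      (Eventually.of_forall fun r => (h.contDiff_apply r).continuous.aestronglyMeasurable)
      ((h.contDiff_apply s).continuous.integrable_of_hasCompactSupport (h.hasCompactSupport s))
      hcont.aestronglyMeasurable (Eventually.of_forall hbound)
      ((integrable_indicator_iff measurableSet_closedBall).2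
        (integrableOn_const measure_closedBall_lt_top.ne))
      (Eventually.of_forall fun x r _ => h.hasDerivAt_time r x)).2
    refine this.congr_deriv ?_
    have h2 : ∀ x, fderiv ℝ (fun p : ℝ × Plane => ω p.1 p.2) (s, x) (1, 0) =
        -inner ℝ (VortexPatch.biotSavart (ω s) x) (∇ (ω s) x) := by
      intro x
      have := h.transport s x
      rw [(h.hasDerivAt_time s x).deriv, h.eq_biotSavart] at this
      linarith
    simp_rw [h2]
    rw [integral_neg, integral_inner_biotSavart_gradient (h.contDiff_apply s)
      (h.hasCompactSupport s), neg_zero]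
  have := is_const_of_deriv_eq_zero (fun s => (hd s).differentiableAt) (fun s => (hd s).deriv) t 0
  rw [this]
  exact integral_congr_ae (Eventually.of_forall fun x => h.initial x)

end IsVorticitySolution

end Solution

/-! ### The initial scalar: lower gradient bounds and the Hölder seminorm. -/

section Scalar

variable {k : ℕ} {μ m : ℝ} {φ₀ : Plane → ℝ}

lemma HolderClass.contDiff_one (h : HolderClass k μ φ₀) (hk : 1 ≤ k) : ContDiff ℝ 1 φ₀ :=
  h.1.of_le (by exact_mod_cast hk)

lemma HolderClass.exists_abs_le (h : HolderClass k μ φ₀) : ∃ C, ∀ x, |φ₀ x| ≤ C := by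
  obtain ⟨C, hC⟩ := (h.2 0 (Nat.zero_le k)).1
  exact ⟨C, fun x => by simpa [norm_iteratedFDeriv_zero] using hC x⟩

lemma HolderClass.exists_norm_fderiv_le (h : HolderClass k μ φ₀) (hk : 1 ≤ k) :
    ∃ C, 0 ≤ C ∧ ∀ x, ‖fderiv ℝ φ₀ x‖ ≤ C := by
  obtain ⟨C, hC⟩ := (h.2 1 hk).1
  simp_rw [norm_iteratedFDeriv_one] at hC
  exact ⟨C, (norm_nonneg _).trans (hC 0), hC⟩

lemma HolderClass.exists_norm_fderiv_sub_le (h : HolderClass k μ φ₀) (hk : 1 ≤ k) :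
    ∃ C, 0 ≤ C ∧ ∀ x y, ‖fderiv ℝ φ₀ x - fderiv ℝ φ₀ y‖ ≤ C * ‖x - y‖ ^ μ := by
  obtain ⟨C, hC⟩ := (h.2 1 hk).2
  refine ⟨max C 0, le_max_right _ _, fun x y => ?_⟩
  refine ContinuousLinearMap.opNorm_le_bound _ (by positivity) fun e => ?_
  have h1 : (fderiv ℝ φ₀ x - fderiv ℝ φ₀ y) e =
      (iteratedFDeriv ℝ 1 φ₀ x - iteratedFDeriv ℝ 1 φ₀ y) fun _ => e := by
    simp [iteratedFDeriv_one_apply]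
  rw [h1]
  refine (ContinuousMultilinearMap.le_opNorm _ _).trans ?_
  simp only [Finset.univ_unique, Finset.prod_const, Finset.card_singleton, pow_one]
  gcongr
  refine (hC x y).trans ?_
  gcongr
  exact le_max_left _ _

lemma gradLevelInf_le {M : ℕ} {φ : Plane → ℝ} {x : Plane}
    (hx : φ x ∈ Icc (0 : ℝ) (2 / (M : ℝ))) : gradLevelInf M φ ≤ ‖fderiv ℝ φ x‖ := by
  rw [← norm_gradient_eq]
  refine csInf_le ⟨0, ?_⟩ ⟨x, hx, rfl⟩
  rintro _ ⟨y, _, rfl⟩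
  exact norm_nonneg _

/-- A zero of `φ` keeps the set nonempty; otherwise the infimum would take the default value `0`. -/
lemma le_gradLevelInf {M : ℕ} {φ : Plane → ℝ} {c : ℝ} (hz : ∃ x, φ x = 0)
    (h : ∀ x, φ x ∈ Icc (0 : ℝ) (2 / (M : ℝ)) → c ≤ ‖fderiv ℝ φ x‖) : c ≤ gradLevelInf M φ := by
  obtain ⟨x₀, hx₀⟩ := hz
  refine le_csInf ⟨_, x₀, ?_, rfl⟩ ?_
  · rw [hx₀]
    exact ⟨le_rfl, by positivity⟩
  · rintro _ ⟨x, hx, rfl⟩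
    rw [norm_gradient_eq]
    exact h x hx

/-- Without zeros `gradInf` would be `sInf ∅ = 0`, against `0 < m ≤ gradInf φ₀`. -/
lemma IsInitialScalar.exists_zero (h : IsInitialScalar k μ m φ₀) : ∃ x, φ₀ x = 0 := by
  by_contra! hne
  have h1 := h.gradInf_ge
  have : {r : ℝ | ∃ x, φ₀ x = 0 ∧ r = ‖∇ φ₀ x‖} = ∅ := by
    ext r
    simp [hne]
  rw [gradInf, this, Real.sInf_empty] at h1
  linarith [h.pos]

lemma IsInitialScalar.le_norm_fderiv (h : IsInitialScalar k μ m φ₀) {x : Plane} (hx : φ₀ x = 0) :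
    m ≤ ‖fderiv ℝ φ₀ x‖ := by
  rw [← norm_gradient_eq]
  refine h.gradInf_ge.trans (csInf_le ⟨0, ?_⟩ ⟨x, hx, rfl⟩)
  rintro _ ⟨y, _, rfl⟩
  exact norm_nonneg _

/-- The gradient is bounded below on a neighbourhood of the boundary inside the patch. -/
theorem IsInitialScalar.exists_sufficientlyLarge (h : IsInitialScalar k μ m φ₀) (hk : 1 ≤ k) :
    ∃ M, SufficientlyLarge m φ₀ M := by
  have hd := h.holder.contDiff_one hk
  have hm := h.pos
  -- On this compact set `φ₀` has no zeros, where the gradient is at least `m`; so it has a positive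
  -- lower bound `c` there, and values below `c` are not taken on `K`.
  set K : Set Plane := closure (patch φ₀) ∩ {x | ‖fderiv ℝ φ₀ x‖ ≤ m / 2} with hK
  have hKc : IsCompact K := h.bounded.isCompact_closure.inter_right
    (isClosed_le (hd.continuous_fderiv one_ne_zero).norm continuous_const)
  have hKpos : ∀ x ∈ K, 0 < φ₀ x := by
    rintro x ⟨hx1, hx2⟩
    have h0 : 0 ≤ φ₀ x := by
      have : closure (patch φ₀) ⊆ {x | 0 ≤ φ₀ x} :=
        closure_minimal (fun y (hy : 0 < φ₀ y) => hy.le) (isClosed_le continuous_const hd.continuous)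
      exact this hx1
    refine lt_of_le_of_ne h0 fun h1 => ?_
    have := h.le_norm_fderiv h1.symm
    have h2 : ‖fderiv ℝ φ₀ x‖ ≤ m / 2 := hx2
    linarith
  obtain ⟨c, hc, hcK⟩ : ∃ c, 0 < c ∧ ∀ x ∈ K, c ≤ φ₀ x := by
    rcases K.eq_empty_or_nonempty with hKe | hKn
    · exact ⟨1, one_pos, by simp [hKe]⟩
    · obtain ⟨x, hx, hmin⟩ := hKc.exists_isMinOn hKn hd.continuous.continuousOn
      exact ⟨φ₀ x, hKpos x hx, fun y hy => hmin hy⟩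
  obtain ⟨M, hM⟩ := exists_nat_gt (2 / c)
  have hM0 : (0 : ℝ) < M := lt_trans (by positivity) hM
  refine ⟨M, by exact_mod_cast hM0, fun j hj => le_gradLevelInf h.exists_zero fun x hx => ?_⟩
  have hjM : (M : ℝ) ≤ j := by exact_mod_cast hj
  rcases hx.1.eq_or_lt with h0 | h0
  · have := h.le_norm_fderiv h0.symm
    linarith
  · by_contra hcon
    have h1 := hcK x ⟨subset_closure h0, (not_le.1 hcon).le⟩
    have h2 : 2 / (j : ℝ) ≤ 2 / M := by gcongr
    have h3 : 2 / (M : ℝ) < c := by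
      rw [div_lt_iff₀ hM0]
      rw [div_lt_iff₀ hc] at hM
      linarith
    linarith [hx.2]

/-- Some Hölder bound `C` is needed for the quotients to be bounded, so that `sSup` is a true
supremum and not `0`. -/
lemma norm_gradient_sub_le_gradHolder {φ : Plane → ℝ} {C : ℝ} (hμ : 0 < μ)
    (h : ∀ x y, ‖fderiv ℝ φ x - fderiv ℝ φ y‖ ≤ C * ‖x - y‖ ^ μ) (x y : Plane) :
    ‖fderiv ℝ φ x - fderiv ℝ φ y‖ ≤ gradHolder μ φ * ‖x - y‖ ^ μ := by
  rcases eq_or_ne x y with rfl | hxy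
  · simp [Real.zero_rpow hμ.ne']
  have hpos : ∀ {x y : Plane}, x ≠ y → 0 < ‖x - y‖ ^ μ := fun hxy =>
    Real.rpow_pos_of_pos (norm_pos_iff.2 (sub_ne_zero.2 hxy)) _
  rw [← div_le_iff₀ (hpos hxy), ← norm_gradient_sub_eq]
  refine le_csSup ⟨C, ?_⟩ ⟨x, y, hxy, rfl⟩
  rintro _ ⟨x, y, hxy, rfl⟩
  rw [div_le_iff₀ (hpos hxy), norm_gradient_sub_eq]
  exact h x y

/-- A bounded function with a nonzero derivative somewhere has a positive Hölder seminorm. -/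
lemma gradHolder_pos {φ : Plane → ℝ} {C G : ℝ} (hμ : 0 < μ) (hφ : Differentiable ℝ φ)
    (h : ∀ x y, ‖fderiv ℝ φ x - fderiv ℝ φ y‖ ≤ C * ‖x - y‖ ^ μ) (hb : ∀ x, |φ x| ≤ G)
    (hne : ∃ x, fderiv ℝ φ x ≠ 0) : 0 < gradHolder μ φ := by
  by_contra hcon
  -- With a nonpositive seminorm the derivative is constant and `φ` is affine; a bounded affine
  -- function has zero derivative.
  have hconst : ∀ x y, ‖fderiv ℝ φ x - fderiv ℝ φ y‖ ≤ 0 * ‖x - y‖ ^ μ := by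
    intro x y
    refine (norm_gradient_sub_le_gradHolder hμ h x y).trans ?_
    gcongr
    exact not_lt.1 hcon
  obtain ⟨x, hx⟩ := hne
  apply hx
  have hlin : ∀ e, φ (x + e) - φ x = fderiv ℝ φ x e := by
    intro e
    have := norm_sub_sub_fderiv_le hμ le_rfl hφ hconst x (x + e)
    rw [zero_mul, add_sub_cancel_left, norm_le_zero_iff] at this
    linarith
  ext e
  by_contra he
  have he' : 0 < |fderiv ℝ φ x e| := abs_pos.2 he
  obtain ⟨N, hN⟩ := exists_nat_gt (2 * G / |fderiv ℝ φ x e|)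
  rw [div_lt_iff₀ he'] at hN
  have h1 := hlin ((N : ℝ) • e)
  rw [map_smul, smul_eq_mul] at h1
  have h2 : (N : ℝ) * |fderiv ℝ φ x e| = |φ (x + (N : ℝ) • e) - φ x| := by
    rw [h1, abs_mul, Nat.abs_cast]
  have h3 := abs_sub (φ (x + (N : ℝ) • e)) (φ x)
  linarith [hb (x + (N : ℝ) • e), hb x]

lemma pi_mul_patchRadius_sq (φ : Plane → ℝ) :
    Real.pi * patchRadius φ ^ 2 = volume.real (patch φ) := by
  rw [patchRadius, Real.sq_sqrt (by positivity)]
  field_simp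

end Scalar

/-! ### The transported scalar and the total variation of the vorticity. -/

section Transport

variable {k n : ℕ} {μ m ω₀ t : ℝ} {φ₀ w₀ : Plane → ℝ} {ρ : ℝ → ℝ} {ω : ℝ → Plane → ℝ}
  {v X : ℝ → Plane → Plane}

lemma IsParticleTrajectory.isFlowFrom (hX : IsParticleTrajectory v X) : IsFlowFrom v 0 X :=
  ⟨hX.hasDerivAt, hX.initial⟩

/-- The regularity of the transported scalar and the nondegeneracy of its gradient. -/
lemma exists_transportedScalar_regular (hμ₀ : 0 < μ) (hμ₁ : μ < 1)
    (hφ₀ : HolderClass k μ φ₀) (hk : 1 ≤ k)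
    (hω : IsVorticitySolution w₀ ω v) (hX : IsParticleTrajectory v X) (t : ℝ) :
    Function.Surjective (X t) ∧ Function.Injective (X t) ∧
    ContDiff ℝ 1 (transportedScalar φ₀ X t) ∧
    (∃ C, ∀ x y, ‖fderiv ℝ (transportedScalar φ₀ X t) x -
      fderiv ℝ (transportedScalar φ₀ X t) y‖ ≤ C * ‖x - y‖ ^ μ) ∧
    ∃ Q : ℝ, 0 < Q ∧ ∀ α, ‖fderiv ℝ φ₀ α‖ ≤
      ‖fderiv ℝ (transportedScalar φ₀ X t) (X t α)‖ * Q := by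
  obtain ⟨B, H, hv⟩ := hω.isRegularField hμ₀ hμ₁ (abs_nonneg t)
  have hflow := hX.isFlowFrom
  have h0 : |(0 : ℝ)| ≤ |t| := by simp
  have hsurj := hflow.surjective hv le_rfl
  have hinj := hflow.injective hv le_rfl
  -- The inverse map is the flow from time `t` evaluated at time `0`, so the regularity theorem for
  -- flows covers it too.
  have hback := hflow.invFun_isFlowFrom hsurj
  set Z : Plane → Plane := Function.invFun (X t) with hZ
  have hZ0 : (fun x => X 0 (Z x)) = Z := funext fun x => hX.initial _
  set Q := Real.exp (2 * |t| * B) with hQ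
  have hQ0 : 0 < Q := Real.exp_pos _
  obtain ⟨A, C, hC0, hA, hAQ, hAC⟩ := hback.exists_hasFDerivAt hv hμ₀ le_rfl h0
  have hlip := hback.lipschitz hv le_rfl h0
  rw [hZ0] at hA
  simp_rw [hX.initial] at hlip
  obtain ⟨A', _, _, hA', hAQ', _⟩ := hflow.exists_hasFDerivAt hv hμ₀ h0 le_rfl
  obtain ⟨G₀, hG₀, hG⟩ := hφ₀.exists_norm_fderiv_le hk
  obtain ⟨C₀, hC₀, hC⟩ := hφ₀.exists_norm_fderiv_sub_le hk
  have hd₀ := (hφ₀.contDiff_one hk).differentiable one_ne_zero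
  have hφ : ∀ x, HasFDerivAt (transportedScalar φ₀ X t) ((fderiv ℝ φ₀ (Z x)).comp (A x)) x :=
    fun x => (hd₀ (Z x)).hasFDerivAt.comp x (hA x)
  have hhol : ∀ x y, ‖fderiv ℝ (transportedScalar φ₀ X t) x -
      fderiv ℝ (transportedScalar φ₀ X t) y‖ ≤ (C₀ * Q ^ μ * Q + G₀ * C) * ‖x - y‖ ^ μ := by
    intro x y
    rw [(hφ x).fderiv, (hφ y).fderiv]
    have hsplit : (fderiv ℝ φ₀ (Z x)).comp (A x) - (fderiv ℝ φ₀ (Z y)).comp (A y) =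
        (fderiv ℝ φ₀ (Z x) - fderiv ℝ φ₀ (Z y)).comp (A x) +
          (fderiv ℝ φ₀ (Z y)).comp (A x - A y) := by
      ext e; simp
    rw [hsplit]
    have h1 : ‖fderiv ℝ φ₀ (Z x) - fderiv ℝ φ₀ (Z y)‖ ≤ C₀ * Q ^ μ * ‖x - y‖ ^ μ := by
      refine (hC _ _).trans ?_
      rw [mul_assoc, ← Real.mul_rpow hQ0.le (norm_nonneg _)]
      gcongr
      exact hlip x y
    calc _ ≤ _ := norm_add_le _ _
      _ ≤ ‖fderiv ℝ φ₀ (Z x) - fderiv ℝ φ₀ (Z y)‖ * ‖A x‖ +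
          ‖fderiv ℝ φ₀ (Z y)‖ * ‖A x - A y‖ :=
        add_le_add (ContinuousLinearMap.opNorm_comp_le _ _) (ContinuousLinearMap.opNorm_comp_le _ _)
      _ ≤ C₀ * Q ^ μ * ‖x - y‖ ^ μ * Q + G₀ * (C * ‖x - y‖ ^ μ) := by
        gcongr
        · exact hAQ x
        · exact hG _
        · exact hAC x y
      _ = _ := by ring
  refine ⟨hsurj, hinj, ?_, ⟨_, hhol⟩, Q, hQ0, fun α => ?_⟩
  · rw [contDiff_one_iff_fderiv]
    exact ⟨fun x => (hφ x).differentiableAt, continuous_of_norm_sub_le hμ₀ hhol⟩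
  -- The chain rule applied to this identity bounds the gradient of the transported scalar from
  -- below, as `X t` has derivative at most `Q`.
  · have hcomp : transportedScalar φ₀ X t ∘ X t = φ₀ := by
      ext β
      simp [transportedScalar, Function.leftInverse_invFun hinj β]
    have h2 := ((hφ (X t α)).differentiableAt.hasFDerivAt.comp α (hA' α)).fderiv
    rw [hcomp] at h2
    rw [h2]
    refine (ContinuousLinearMap.opNorm_comp_le _ _).trans ?_
    gcongr
    exact hAQ' α

/-- The total variation of the vorticity is controlled by the area of the initial patch. -/
lemma integral_abs_vorticity_le (hρ : IsMollifier ρ) (hn : 1 ≤ n) (hφ₀c : Continuous φ₀)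
    (hφ₀b : Bornology.IsBounded (patch φ₀))
    (hω : IsVorticitySolution (fun x => ω₀ * smoothHeaviside ρ n (φ₀ x)) ω v)
    {h : Plane → ℝ} (h0 : ∀ x, 0 ≤ h x) (hh : ∀ x, ω t x = ω₀ * h x) :
    ∫ x, |ω t x| ≤ |ω₀| * (Real.pi * patchRadius φ₀ ^ 2) := by
  rw [pi_mul_patchRadius_sq]
  -- The vorticity has the constant sign of `ω₀`, so conservation of its integral gives conservation
  -- of its `L¹` norm, without knowing that the flow preserves area.
  obtain ⟨σ, hσ⟩ : ∃ σ : ℝ, ∀ y, 0 ≤ y → |ω₀ * y| = σ * (ω₀ * y) := by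
    rcases le_total 0 ω₀ with h | h
    · exact ⟨1, fun y hy => by rw [one_mul, abs_of_nonneg (mul_nonneg h hy)]⟩
    · exact ⟨-1, fun y hy => by rw [neg_one_mul, abs_of_nonpos (mul_nonpos_of_nonpos_of_nonneg h hy)]⟩
  have h1 : ∫ x, |ω t x| = ∫ x, |ω₀ * smoothHeaviside ρ n (φ₀ x)| := by
    simp_rw [hh, hσ _ (h0 _), hσ _ (hρ.smoothHeaviside_nonneg _)]
    rw [integral_const_mul σ, integral_const_mul σ, ← hω.integral_eq t]
    simp_rw [hh]
  have hm : MeasurableSet (patch φ₀) := (isOpen_lt continuous_const hφ₀c).measurableSet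
  have hfin : volume (patch φ₀) ≠ ⊤ := hφ₀b.measure_lt_top.ne
  rw [h1]
  calc ∫ x, |ω₀ * smoothHeaviside ρ n (φ₀ x)| ≤ ∫ x, (patch φ₀).indicator (fun _ => |ω₀|) x := by
        refine integral_mono_of_nonneg (Eventually.of_forall fun x => abs_nonneg _)
          ((integrable_indicator_iff hm).2 (integrableOn_const hfin))
          (Eventually.of_forall fun x => ?_)
        simp only
        by_cases hx : x ∈ patch φ₀
        · rw [indicator_of_mem hx, abs_mul, abs_of_nonneg (hρ.smoothHeaviside_nonneg _)]
          exact mul_le_of_le_one_right (abs_nonneg _) (hρ.smoothHeaviside_le_one hn _)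
        · rw [indicator_of_notMem hx, hρ.smoothHeaviside_eq_zero hn (not_lt.1 hx)]
          simp
    _ = |ω₀| * volume.real (patch φ₀) := by
        rw [integral_indicator hm, setIntegral_const, smul_eq_mul, mul_comm]

end Transport

end VortexPatch

end

/-! ### Assembly of the proposition. -/

theorem proposition3p2 (μ : ℝ) (hμ₀ : 0 < μ) (hμ₁ : μ < 1) :
    ∃ C : ℝ, ∀ (k : ℕ) (m : ℝ) (φ₀ : VortexPatch.Plane → ℝ), 1 ≤ k →
      VortexPatch.IsInitialScalar k μ m φ₀ →
      (∃ M : ℕ, VortexPatch.SufficientlyLarge m φ₀ M) ∧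
      ∀ (ρ : ℝ → ℝ) (M n : ℕ) (ω₀ : ℝ)
        (φ : ℝ → VortexPatch.Plane → ℝ) (v : ℝ → VortexPatch.Plane → VortexPatch.Plane),
        VortexPatch.IsMollifier ρ →
        VortexPatch.SufficientlyLarge m φ₀ M → M ≤ n →
        VortexPatch.IsApproxSolution ρ n ω₀ φ₀ φ v →
        ∀ t : ℝ,
          ContDiff ℝ 1 (φ t) ∧ 0 < VortexPatch.lengthScale M μ (φ t) ∧
          Differentiable ℝ (v t) ∧
          ∀ x : VortexPatch.Plane, ‖fderiv ℝ (v t) x‖ ≤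
            C * |ω₀| * (1 + Real.log (1 +
              VortexPatch.patchRadius φ₀ / VortexPatch.lengthScale M μ (φ t))) := by
  refine ⟨5 + 8 / μ + Real.log 16 / μ, fun k m φ₀ hk hφ₀ =>
    ⟨hφ₀.exists_sufficientlyLarge hk, ?_⟩⟩
  rintro ρ M n ω₀ φ v hρ ⟨hM1, hM⟩ hMn ⟨ω, X, hω, hX, rfl⟩ t
  have hn : 1 ≤ n := hM1.trans hMn
  have hm := hφ₀.pos
  obtain ⟨hsurj, hinj, hcd, ⟨C, hC⟩, Q, hQ, hQφ⟩ :=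
    VortexPatch.exists_transportedScalar_regular hμ₀ hμ₁ hφ₀.holder hk hω hX t
  set φt := VortexPatch.transportedScalar φ₀ X t with hφt
  have hφX : ∀ α, φt (X t α) = φ₀ α := fun α => by
    simp [hφt, VortexPatch.transportedScalar, Function.leftInverse_invFun hinj α]
  -- A lower bound that degenerates with time through `Q`, used only to know that the infimum in
  -- `Δ_n` is positive.
  have hlow : ∀ x, φt x ∈ Set.Icc (0 : ℝ) (2 / (M : ℝ)) → m / 2 / Q ≤ ‖fderiv ℝ φt x‖ := by
    intro x hx
    obtain ⟨α, rfl⟩ := hsurj x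
    rw [hφX] at hx
    rw [div_le_iff₀ hQ]
    exact ((hM M le_rfl).trans (VortexPatch.gradLevelInf_le hx)).trans (hQφ α)
  obtain ⟨α₀, hα₀⟩ := hφ₀.exists_zero
  have hzero : φt (X t α₀) = 0 := by rw [hφX, hα₀]
  have hg0 : 0 < VortexPatch.gradLevelInf M φt :=
    lt_of_lt_of_le (by positivity) (VortexPatch.le_gradLevelInf ⟨_, hzero⟩ hlow)
  have hzmem : φt (X t α₀) ∈ Set.Icc (0 : ℝ) (2 / (M : ℝ)) := by
    rw [hzero]; exact ⟨le_rfl, by positivity⟩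
  obtain ⟨G, hG⟩ := hφ₀.holder.exists_abs_le
  have hφd : Differentiable ℝ φt := hcd.differentiable one_ne_zero
  have hH : 0 < VortexPatch.gradHolder μ φt := VortexPatch.gradHolder_pos hμ₀ hφd hC
    (fun x => hG _) ⟨X t α₀, norm_pos_iff.1 (hg0.trans_le (VortexPatch.gradLevelInf_le hzmem))⟩
  have hvort : ∀ x, ω t x = ω₀ * VortexPatch.smoothHeaviside ρ n (φt x) := by
    intro x
    obtain ⟨α, rfl⟩ := hsurj x
    rw [hφX]
    exact hω.apply_trajectory hX t α
  refine ⟨hcd, Real.rpow_pos_of_pos (div_pos hg0 hH) _, ?_, fun x => ?_⟩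
  · rw [hω.eq_biotSavart]
    exact VortexPatch.differentiable_biotSavart (hω.contDiff_apply t) (hω.hasCompactSupport t)
  · rw [hω.eq_biotSavart]
    -- Applied with the actual infimum over `[0, 2/M]` and the actual Hölder seminorm, so the length
    -- is `Δ_n` itself; the levels `[0, 2/n]` are covered since `M ≤ n`.
    refine VortexPatch.norm_fderiv_biotSavart_le hμ₀ hμ₁ hρ hn hφd hg0 hH (Real.sqrt_nonneg _)
      (fun y hy => VortexPatch.gradLevelInf_le ⟨hy.1, hy.2.trans ?_⟩)
      (VortexPatch.norm_gradient_sub_le_gradHolder hμ₀ hC) (hω.contDiff_apply t)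
      (hω.hasCompactSupport t) hvort
      (VortexPatch.integral_abs_vorticity_le hρ hn (hφ₀.holder.contDiff_one hk).continuous
        hφ₀.bounded hω (fun y => hρ.smoothHeaviside_nonneg _) hvort) x
    have hM0 : (0 : ℝ) < M := by exact_mod_cast hM1
    gcongr
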